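/- **Setting.** Let $A$ be an $n\times n$ complex matrix with all eigenvalues in the open unit disc (a stable matrix), let $C$, $\Gamma$, $R_0$ be complex matrices of sizes $m\times n$, $n\times m$, $m\times m$, and let $$R(z)=zC(I_n-zA)^{-1}\Gamma+R_0+\Gamma^*(zI_n-A^*)^{-1}C^* .$$ Write $\ell^2_+(\mathbb C^k)$ for the space of square summable unilateral sequences in $\mathbb C^k$, and $E:\mathbb C^k\to\ell^2_+(\mathbb C^k)$ for the embedding onto the first coordinate space. For a bounded measurable $k\times l$ matrix function $\Omega$ on the unit circle $\mathbb T$ with Fourier coefficients $\Omega_j$, let $T_\Omega=[\Omega_{i-j}]_{i,j\ge 0}:\ell^2_+(\mathbb C^l)\to\ell^2_+(\mathbb C^k)$ be its block Toeplitz operator. For a pair $\{C,A\}$ with $A$ stable, $W_{obs}x=(Cx,CAx,CA^2x,\dots)$ is its observability operator. For an invertible operator $\Xi$, $\Xi^{-*}$ is the adjoint of $\Xi^{-1}$. An outer spectral factor of $R$ is a rational $r\times m$ matrix function $\Phi$ without poles in the closed unit disc such that $R(z)=\Phi(\bar z^{-1})^*\Phi(z)$ and $T_\Phi$ has dense range in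 $\ell^2_+(\mathbb C^r)$. Given such $\Phi$, put $\mathcal X_\Phi=\{x\in\mathbb C^n : W_{obs}x\in \operatorname{Im}T_\Phi^*\}$, and let $C_\Phi$ denote an $r\times n$ matrix such that $$\Phi(z)=\Phi(0)+zC_\Phi(I_n-zA)^{-1}\Gamma ,\qquad W_{obs}x=T_\Phi^*W_{\Phi,obs}x\quad(x\in\mathcal X_\Phi),\tag{1}$$ where $W_{\Phi,obs}$ is the observability operator of $\{C_\Phi,A\}$. Let $Q_\Phi=\sum_{\nu\ge0}(A^\nu)^*C_\Phi^*C_\Phi A^\nu$. **Proposition 5.1.** Assume that $R(\zeta)$ is strictly positive for each $\zeta\in\mathbb T$, and let $\Phi$ (of size $r\times m$) be an outer spectral factor of $R$. Then $r=m$, the operators $T_\Phi$ and $T_R$ are invertible, $\mathcal X_\Phi=\mathbb C^n$, and there is exactly one matrix $C_\Phi$ with the properties (1). It satisfies $$C_\Phi=E^*T_\Phi^{-*}W_{obs},\qquad W_{\Phi,obs}=T_\Phi^{-*}W_{obs},\qquad Q_\Phi=W_{obs}^*T_R^{-1}W_{obs},$$ the matrix $R_0-\Gamma^*Q_\Phi\Gamma$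 is strictly positive, and $$C_\Phi=\Phi(0)\,(R_0-\Gamma^*Q_\Phi\Gamma)^{-1}(C-\Gamma^*Q_\Phi A).$$ Finally, one may assume without loss of generality that $\Phi(0)=(R_0-\Gamma^*Q_\Phi\Gamma)^{1/2}$: there is a constant unitary matrix $U$ such that $U\Phi$ is an outer spectral factor of $R$, the matrix $C_{U\Phi}=UC_\Phi$ has the properties (1) relative to $U\Phi$, $Q_{U\Phi}=Q_\Phi$, and $U\Phi(0)=(R_0-\Gamma^*Q_{U\Phi}\Gamma)^{1/2}$. -/

import Mathlib

open Filter MeasureTheory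
open scoped ENNReal Matrix ComplexConjugate ComplexOrder

noncomputable section

namespace OuterFactor

/-! ### Spaces and block operators -/

/-- `ℂᵏ` with its Euclidean inner product. -/
abbrev Vec (k : ℕ) : Type := EuclideanSpace ℂ (Fin k)

/-- `ℓ²₊(ℂᵏ)`: square summable unilateral sequences of vectors in `ℂᵏ`. -/
abbrev SeqSpace (k : ℕ) : Type := lp (fun _ : ℕ => Vec k) 2

/-- The operator `ℂˡ → ℂᵏ` given by a `k × l` matrix. -/
def matOp {k l : ℕ} (M : Matrix (Fin k) (Fin l) ℂ) : Vec l →L[ℂ] Vec k :=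
  LinearMap.toContinuousLinearMap (Matrix.toEuclideanLin M)

/-- The canonical embedding `E` of `ℂᵏ` onto the first coordinate space of `ℓ²₊(ℂᵏ)`. -/
def firstEmb (k : ℕ) : Vec k →L[ℂ] SeqSpace k :=
  lp.singleContinuousLinearMap ℂ (fun _ : ℕ => Vec k) 2 0

/-! ### Toeplitz operators

The unit circle is parametrized by `t ↦ e^{2πit}`, `t ∈ ℝ/ℤ`, with normalized Haar measure. -/

/-- Normalized Lebesgue measure on the circle. -/
abbrev circleMeasure : Measure UnitAddCircle := AddCircle.haarAddCircle

/-- `L²(𝕋; ℂᵏ)`. -/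
abbrev L2Circle (k : ℕ) : Type := Lp (Vec k) 2 circleMeasure

/-- The boundary function `t ↦ Ω(e^{2πit})`, with operator values, of a matrix function `Ω`. -/
def boundary {k l : ℕ} (Ω : ℂ → Matrix (Fin k) (Fin l) ℂ) (t : UnitAddCircle) :
    Vec l →L[ℂ] Vec k :=
  matOp (Ω (AddCircle.toCircle t : ℂ))

/-- `u ↦ ζʲ u`, as an isometry from `ℂᵏ` into `L²(𝕋; ℂᵏ)`. -/
def monomialEmb (k : ℕ) (j : ℕ) : Vec k →ₗᵢ[ℂ] L2Circle k where
  toFun u := ContinuousMap.toLp 2 circleMeasure ℂ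
    ⟨fun t => fourier (j : ℤ) t • u, by fun_prop⟩
  map_add' u v := by
    rw [← map_add]; congr 1; ext1 t; simp
  map_smul' c u := by
    rw [RingHom.id_apply, ← map_smul]; congr 1; ext1 t
    simp [smul_comm c]
  norm_map' u := by
    change ‖ContinuousMap.toLp 2 circleMeasure ℂ
      (⟨fun t => fourier (j : ℤ) t • u, by fun_prop⟩ : C(UnitAddCircle, Vec k))‖ = ‖u‖
    rw [Lp.norm_def, eLpNorm_congr_ae (ContinuousMap.coeFn_toLp _ _)]
    have : eLpNorm (fun t : UnitAddCircle => fourier (j : ℤ) t • u) 2 circleMeasure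
        = eLpNorm (fun _ : UnitAddCircle => u) 2 circleMeasure := by
      apply eLpNorm_congr_norm_ae
      refine Eventually.of_forall fun t => ?_
      rw [norm_smul, fourier_apply, Circle.norm_coe, one_mul]
    change (eLpNorm (fun t : UnitAddCircle => fourier (j : ℤ) t • u) 2 circleMeasure).toReal = _
    rw [this, eLpNorm_const' u (by norm_num) (by norm_num)]
    simp

theorem coeFn_monomialEmb (k j : ℕ) (u : Vec k) :
    monomialEmb k j u =ᵐ[circleMeasure] fun t => fourier (j : ℤ) t • u :=
  ContinuousMap.coeFn_toLp _ _

theorem orthogonalFamily_monomialEmb (k : ℕ) :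
    OrthogonalFamily ℂ (fun _ : ℕ => Vec k) (monomialEmb k) := by
  intro i j hij u v
  have h0 := (orthonormal_iff_ite.mp (orthonormal_fourier (T := 1))) i j
  rw [if_neg (by exact_mod_cast hij), ContinuousMap.inner_toLp] at h0
  rw [L2.inner_def]
  have : (fun t => inner ℂ (monomialEmb k i u t) (monomialEmb k j v t)) =ᵐ[circleMeasure]
      fun t => (fourier (j : ℤ) t * conj (fourier (i : ℤ) t)) * inner ℂ u v := by
    filter_upwards [coeFn_monomialEmb k i u, coeFn_monomialEmb k j v] with t h1 h2
    rw [h1, h2, inner_smul_left, inner_smul_right]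
    ring
  rw [integral_congr_ae this, integral_mul_const]
  exact mul_eq_zero_of_left h0 _

/-- The isometry `(f₀, f₁, …) ↦ ∑ⱼ ζʲ fⱼ` of `ℓ²₊(ℂᵏ)` onto the Hardy space `H²(ℂᵏ) ⊆ L²(𝕋; ℂᵏ)`. -/
def hardyEmb (k : ℕ) : SeqSpace k →ₗᵢ[ℂ] L2Circle k :=
  (orthogonalFamily_monomialEmb k).linearIsometry

open Classical in
/-- The class in `L^∞` of the boundary function of a matrix function that is measurable and
essentially bounded on the circle (and `0` for other matrix functions). -/
def symbolLp {k l : ℕ} (Ω : ℂ → Matrix (Fin k) (Fin l) ℂ) :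
    Lp (Vec l →L[ℂ] Vec k) ∞ circleMeasure :=
  if h : MemLp (boundary Ω) ∞ circleMeasure then h.toLp else 0

/-- The operator of multiplication by `Ω ∈ L^∞`, from `L²(𝕋; ℂˡ)` to `L²(𝕋; ℂᵏ)`. -/
def mulOp {k l : ℕ} (Ω : ℂ → Matrix (Fin k) (Fin l) ℂ) : L2Circle l →L[ℂ] L2Circle k :=
  (ContinuousLinearMap.id ℂ (Vec l →L[ℂ] Vec k)).holderL circleMeasure ∞ 2 2 (symbolLp Ω)

/-- The block Toeplitz operator `T_Ω : ℓ²₊(ℂˡ) → ℓ²₊(ℂᵏ)` of a `k × l` matrix function `Ω` in `L^∞`: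
the compression to the Hardy spaces of multiplication by `Ω`. Its block matrix is
`[Ω_{i-j}]` with `Ω_j` the Fourier coefficients of `Ω`: see `toeplitz_single`. -/
def toeplitz {k l : ℕ} (Ω : ℂ → Matrix (Fin k) (Fin l) ℂ) : SeqSpace l →L[ℂ] SeqSpace k :=
  (hardyEmb k).toContinuousLinearMap.adjoint ∘L mulOp Ω ∘L (hardyEmb l).toContinuousLinearMap

/-- Matrix functions that are continuous on the unit circle are in `L^∞`. -/
theorem memLp_boundary {k l : ℕ} {Ω : ℂ → Matrix (Fin k) (Fin l) ℂ}
    (hΩ : ContinuousOn Ω (Metric.sphere 0 1)) : MemLp (boundary Ω) ∞ circleMeasure := by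
  have h1 : Continuous fun t : UnitAddCircle => Ω (AddCircle.toCircle t : ℂ) :=
    hΩ.comp_continuous (continuous_subtype_val.comp AddCircle.continuous_toCircle)
      (fun t => by rw [mem_sphere_zero_iff_norm, Circle.norm_coe])
  have h2 : Continuous (boundary Ω) := by
    have h3 : Continuous (fun M : Matrix (Fin k) (Fin l) ℂ => matOp M) :=
      LinearMap.continuous_of_finiteDimensional
        ((LinearMap.toContinuousLinearMap.toLinearMap) ∘ₗ
          (Matrix.toEuclideanLin (𝕜 := ℂ) (m := Fin k) (n := Fin l)).toLinearMap)
    exact h3.comp h1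
  exact (h2.memLp_top_of_hasCompactSupport (HasCompactSupport.of_compactSpace _) _)

theorem integrable_fourier_smul {F : Type*} [NormedAddCommGroup F] [NormedSpace ℂ F]
    {f : UnitAddCircle → F} (hf : Integrable f circleMeasure) (j : ℤ) :
    Integrable (fun t => fourier j t • f t) circleMeasure :=
  hf.bdd_smul 1 (map_continuous (fourier j)).aestronglyMeasurable
    (Eventually.of_forall fun t => by rw [fourier_apply, Circle.norm_coe])

/-- The block entries of `T_Ω` are the Fourier coefficients of `Ω`. -/
theorem toeplitz_single {k l : ℕ} {Ω : ℂ → Matrix (Fin k) (Fin l) ℂ}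
    (hΩ : MemLp (boundary Ω) ∞ circleMeasure) (i j : ℕ) (u : Vec l) :
    toeplitz Ω (lp.single 2 j u) i = fourierCoeff (boundary Ω) ((i : ℤ) - j) u := by
  have hint : Integrable (boundary Ω) circleMeasure := hΩ.integrable (by simp)
  have hint' : Integrable (fun t => fourier (-((i : ℤ) - j)) t • boundary Ω t) circleMeasure := by
    exact integrable_fourier_smul hint _
  apply ext_inner_left ℂ
  intro v
  refine (lp.inner_single_left (𝕜 := ℂ) i v (toeplitz Ω (lp.single 2 j u))).symm.trans ?_
  rw [toeplitz, ContinuousLinearMap.comp_apply,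
    ContinuousLinearMap.adjoint_inner_right, ContinuousLinearMap.comp_apply]
  have e1 : (hardyEmb k).toContinuousLinearMap (lp.single 2 i v) = monomialEmb k i v :=
    (orthogonalFamily_monomialEmb k).linearIsometry_apply_single v
  have e2 : (hardyEmb l).toContinuousLinearMap (lp.single 2 j u) = monomialEmb l j u :=
    (orthogonalFamily_monomialEmb l).linearIsometry_apply_single u
  rw [e1, e2, L2.inner_def]
  have hs : symbolLp Ω =ᵐ[circleMeasure] boundary Ω := by
    rw [symbolLp, dif_pos hΩ]; exact hΩ.coeFn_toLp
  have hm : mulOp Ω (monomialEmb l j u) =ᵐ[circleMeasure]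
      fun t => symbolLp Ω t (monomialEmb l j u t) :=
    ContinuousLinearMap.coeFn_holder (r := 2) (ContinuousLinearMap.id ℂ (Vec l →L[ℂ] Vec k))
      (symbolLp Ω) (monomialEmb l j u)
  have : (fun t => inner ℂ (monomialEmb k i v t) (mulOp Ω (monomialEmb l j u) t))
      =ᵐ[circleMeasure]
      fun t => inner ℂ v ((fourier (-((i : ℤ) - j)) t • boundary Ω t) u) := by
    filter_upwards [hs, hm, coeFn_monomialEmb k i v, coeFn_monomialEmb l j u] with t h1 h2 h3 h4
    rw [h2, h1, h3, h4, map_smul, inner_smul_left, inner_smul_right, _root_.smul_apply,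
      inner_smul_right, ← mul_assoc, ← fourier_neg, ← fourier_add]
    congr 3
    ring
  rw [integral_congr_ae this]
  have h5 : Integrable (fun t => (fourier (-((i : ℤ) - j)) t • boundary Ω t) u) circleMeasure :=
    ((ContinuousLinearMap.apply ℂ (Vec k) u).integrable_comp hint')
  rw [integral_inner h5, fourierCoeff, ContinuousLinearMap.integral_apply hint']

/-! ### Stable matrices and observability -/

/-- A square matrix is stable if its eigenvalues lie in the open unit disc. -/
def IsStable {n : ℕ} (A : Matrix (Fin n) (Fin n) ℂ) : Prop :=
  ∀ z ∈ spectrum ℂ A, ‖z‖ < 1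

theorem IsStable.exists_bound {n : ℕ} {A : Matrix (Fin n) (Fin n) ℂ} (hA : IsStable A) :
    ∃ r : ℝ, 0 ≤ r ∧ r < 1 ∧
      ∀ᶠ ν : ℕ in atTop, ‖Matrix.toEuclideanCLM (𝕜 := ℂ) (n := Fin n) (A ^ ν)‖ ≤ r ^ ν := by
  set a : Vec n →L[ℂ] Vec n := Matrix.toEuclideanCLM (𝕜 := ℂ) (n := Fin n) A with ha
  have hsp : spectrum ℂ a = spectrum ℂ A :=
    AlgEquiv.spectrum_eq (Matrix.toEuclideanCLM (𝕜 := ℂ) (n := Fin n)) A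
  have hρ : spectralRadius ℂ a < 1 := by
    rcases subsingleton_or_nontrivial (Vec n →L[ℂ] Vec n) with h | h
    · rw [Subsingleton.elim a 0, spectrum.spectralRadius_zero]; exact one_pos
    · have := spectrum.spectralRadius_lt_of_forall_lt a (r := 1) (fun z hz => by
        have := hA z (hsp ▸ hz)
        exact_mod_cast this)
      simpa using this
  obtain ⟨r, hr1, hr2⟩ := ENNReal.lt_iff_exists_nnreal_btwn.mp hρ
  refine ⟨r, r.2, by exact_mod_cast hr2, ?_⟩
  have ht := (spectrum.pow_nnnorm_pow_one_div_tendsto_nhds_spectralRadius a).eventually_lt_const hr1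
  filter_upwards [ht, eventually_gt_atTop 0] with ν hν hpos
  have hν' : ((‖a ^ ν‖₊ : ℝ≥0∞)) ≤ (r : ℝ≥0∞) ^ ν := by
    have h1 := ENNReal.rpow_le_rpow hν.le (z := (ν : ℝ)) (by positivity)
    rw [← ENNReal.rpow_mul, one_div_mul_cancel (by positivity), ENNReal.rpow_one,
      ENNReal.rpow_natCast] at h1
    exact h1
  rw [map_pow]
  exact_mod_cast hν'

theorem memℓp_obs {m n : ℕ} (C : Matrix (Fin m) (Fin n) ℂ) {A : Matrix (Fin n) (Fin n) ℂ}
    (hA : IsStable A) (x : Vec n) : Memℓp (fun ν : ℕ => matOp (C * A ^ ν) x) 2 := by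
  obtain ⟨r, hr0, hr1, hr⟩ := hA.exists_bound
  suffices h : Memℓp (fun ν : ℕ => matOp (C * A ^ ν) x) 1 from h.of_exponent_ge (by norm_num)
  rw [memℓp_gen_iff (by simp)]
  simp only [ENNReal.toReal_one, Real.rpow_one]
  have hs : Summable fun ν : ℕ => ‖matOp C‖ * (r ^ ν * ‖x‖) :=
    ((summable_geometric_of_lt_one hr0 hr1).mul_right _).mul_left _
  refine Summable.of_norm_bounded_eventually_nat hs ?_
  filter_upwards [hr] with ν hν
  have : matOp (C * A ^ ν) x = matOp C (Matrix.toEuclideanCLM (𝕜 := ℂ) (n := Fin n) (A ^ ν) x) := by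
    simp only [matOp, LinearMap.coe_toContinuousLinearMap', Matrix.toLpLin_apply]
    congr 1
    rw [← Matrix.mulVec_mulVec]
    rfl
  rw [norm_norm, this]
  refine (ContinuousLinearMap.le_opNorm _ _).trans ?_
  gcongr
  exact (ContinuousLinearMap.le_opNorm _ _).trans (by gcongr)

/-- The observability operator `x ↦ (C x, C A x, C A² x, …)` from `ℂⁿ` into `ℓ²₊(ℂᵐ)` defined by
a pair `{C, A}` with `A` stable. -/
def obsOp {m n : ℕ} (C : Matrix (Fin m) (Fin n) ℂ) {A : Matrix (Fin n) (Fin n) ℂ}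
    (hA : IsStable A) : Vec n →L[ℂ] SeqSpace m :=
  LinearMap.toContinuousLinearMap
    { toFun := fun x => ⟨fun ν => matOp (C * A ^ ν) x, memℓp_obs C hA x⟩
      map_add' := fun x y => by ext1; funext ν; exact map_add _ x y
      map_smul' := fun c x => by ext1; funext ν; exact map_smul _ c x }

/-- The observability Gramian `∑ (A^ν)* C* C A^ν` of a pair `{C, A}`. -/
def obsGramian {m n : ℕ} (C : Matrix (Fin m) (Fin n) ℂ) (A : Matrix (Fin n) (Fin n) ℂ) :
    Matrix (Fin n) (Fin n) ℂ :=
  ∑' ν : ℕ, (A ^ ν)ᴴ * Cᴴ * C * A ^ ν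

theorem summable_obsGramian {m n : ℕ} (C : Matrix (Fin m) (Fin n) ℂ)
    {A : Matrix (Fin n) (Fin n) ℂ} (hA : IsStable A) :
    Summable fun ν : ℕ => (A ^ ν)ᴴ * Cᴴ * C * A ^ ν := by
  refine Pi.summable.mpr fun i => Pi.summable.mpr fun j => ?_
  let e : Fin n → Vec n := fun i => EuclideanSpace.single i 1
  refine (lp.summable_inner (𝕜 := ℂ) (obsOp C hA (e i)) (obsOp C hA (e j))).congr fun ν => ?_
  have h : ∀ i k, (obsOp C hA (e i) ν : Vec m) k = (C * A ^ ν) k i := fun i k => by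
    change ((C * A ^ ν) *ᵥ Pi.single i 1) k = _
    rw [Matrix.mulVec_single_one, Matrix.col_apply]
  rw [PiLp.inner_apply]
  rw [Matrix.mul_assoc, ← Matrix.conjTranspose_mul, Matrix.mul_apply]
  refine Finset.sum_congr rfl fun k _ => ?_
  rw [h, h, Matrix.conjTranspose_apply]
  simp [mul_comm]

/-! ### Rational matrix functions and outer spectral factors -/

/-- Equality of rational matrix functions: equality at all but finitely many points of `ℂ`
(values at poles are irrelevant). -/
def RatEq {k l : ℕ} (F G : ℂ → Matrix (Fin k) (Fin l) ℂ) : Prop :=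
  ∀ᶠ z in cofinite, F z = G z

/-- `Ω ∈ ℜH^∞_{k×l}`: `Ω` is a rational matrix function without poles in the closed unit disc, that
is, a quotient `P / q` with `P` a matrix polynomial and `q` a scalar polynomial without zeros in
the closed unit disc. (Values of `Ω` at zeros of `q` are not specified.) -/
def IsStableRational {k l : ℕ} (Ω : ℂ → Matrix (Fin k) (Fin l) ℂ) : Prop :=
  ∃ (P : Matrix (Fin k) (Fin l) (Polynomial ℂ)) (q : Polynomial ℂ),
    (∀ z : ℂ, ‖z‖ ≤ 1 → q.eval z ≠ 0) ∧
    ∀ z : ℂ, q.eval z ≠ 0 → Ω z = (q.eval z)⁻¹ • P.map (Polynomial.eval z)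

/-- `Ω^*(z) = Ω(z̄⁻¹)^*`. -/
def paraConj {k l : ℕ} (Ω : ℂ → Matrix (Fin k) (Fin l) ℂ) (z : ℂ) : Matrix (Fin l) (Fin k) ℂ :=
  (Ω (conj z)⁻¹)ᴴ

/-- `R(z) = z C (I - z A)⁻¹ Γ + R₀ + Γ* (z I - A*)⁻¹ C*`. -/
def realizedR {m n : ℕ} (A : Matrix (Fin n) (Fin n) ℂ) (C : Matrix (Fin m) (Fin n) ℂ)
    (Γ : Matrix (Fin n) (Fin m) ℂ) (R₀ : Matrix (Fin m) (Fin m) ℂ) (z : ℂ) :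
    Matrix (Fin m) (Fin m) ℂ :=
  z • (C * (1 - z • A)⁻¹ * Γ) + R₀ + Γᴴ * (z • (1 : Matrix (Fin n) (Fin n) ℂ) - Aᴴ)⁻¹ * Cᴴ

/-- `Φ` is an outer spectral factor of `R`: `Φ` is in `ℜH^∞_{r×m}`, `R = Φ^* Φ`, and the range of
`T_Φ` is dense in `ℓ²₊(ℂʳ)`. -/
structure IsOuterSpectralFactor {r m : ℕ} (R : ℂ → Matrix (Fin m) (Fin m) ℂ)
    (Φ : ℂ → Matrix (Fin r) (Fin m) ℂ) : Prop where
  stableRational : IsStableRational Φ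
  factorization : RatEq R (fun z => paraConj Φ z * Φ z)
  outer : DenseRange (toeplitz Φ)

/-- Functions in `ℜH^∞` are continuous on the circle, hence in `L^∞` by `memLp_boundary`. -/
theorem IsStableRational.continuousOn_sphere {k l : ℕ} {Ω : ℂ → Matrix (Fin k) (Fin l) ℂ}
    (hΩ : IsStableRational Ω) : ContinuousOn Ω (Metric.sphere 0 1) := by
  obtain ⟨P, q, hq, h⟩ := hΩ
  have hq' : ∀ z ∈ Metric.sphere (0 : ℂ) 1, q.eval z ≠ 0 := fun z hz =>
    hq z (mem_sphere_zero_iff_norm.mp hz).le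
  refine ContinuousOn.congr ?_ fun z hz => h z (hq' z hz)
  refine (q.continuous.continuousOn.inv₀ hq').smul (Continuous.continuousOn ?_)
  exact continuous_matrix fun i j => (P i j).continuous

/-- For stable `A`, the function `R` is continuous on the circle, hence in `L^∞`. -/
theorem continuousOn_realizedR {m n : ℕ} {A : Matrix (Fin n) (Fin n) ℂ} (hA : IsStable A)
    (C : Matrix (Fin m) (Fin n) ℂ) (Γ : Matrix (Fin n) (Fin m) ℂ) (R₀ : Matrix (Fin m) (Fin m) ℂ) :
    ContinuousOn (realizedR A C Γ R₀) (Metric.sphere 0 1) := by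
  have key : ∀ w : ℂ, ‖w‖ = 1 → IsUnit (w • (1 : Matrix (Fin n) (Fin n) ℂ) - A) := fun w hw => by
    by_contra h
    refine absurd (hA w ?_) (by rw [hw]; exact lt_irrefl _)
    rwa [spectrum.mem_iff, Algebra.algebraMap_eq_smul_one]
  have inv : ∀ f : ℂ → Matrix (Fin n) (Fin n) ℂ, Continuous f →
      (∀ z ∈ Metric.sphere (0 : ℂ) 1, IsUnit (f z)) →
      ContinuousOn (fun z => (f z)⁻¹) (Metric.sphere 0 1) := fun f hf hu => by
    simp only [Matrix.inv_def, Ring.inverse_eq_inv']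
    refine ContinuousOn.smul (ContinuousOn.inv₀ hf.matrix_det.continuousOn fun z hz => ?_)
      hf.matrix_adjugate.continuousOn
    exact ((Matrix.isUnit_iff_isUnit_det _).mp (hu z hz)).ne_zero
  have h1 := inv (fun z => 1 - z • A) (by fun_prop) fun z hz => by
    have hz1 : ‖z‖ = 1 := mem_sphere_zero_iff_norm.mp hz
    have hz0 : z ≠ 0 := by rintro rfl; simp at hz1
    have : (1 : Matrix (Fin n) (Fin n) ℂ) - z • A = (Units.mk0 z hz0) • (z⁻¹ • 1 - A) := by
      rw [Units.smul_mk0, smul_sub, smul_smul, mul_inv_cancel₀ hz0, one_smul]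
    rw [this]
    exact (key z⁻¹ (by rw [norm_inv, hz1, inv_one])).smul _
  have h2 := inv (fun z => z • (1 : Matrix (Fin n) (Fin n) ℂ) - Aᴴ) (by fun_prop) fun z hz => by
    have hz1 : ‖z‖ = 1 := mem_sphere_zero_iff_norm.mp hz
    have := (key (conj z) (by rw [RCLike.norm_conj, hz1])).star
    simpa [Matrix.star_eq_conjTranspose] using this
  unfold realizedR
  have c1 : Continuous fun M : Matrix (Fin n) (Fin n) ℂ => C * M * Γ := by fun_prop
  have c2 : Continuous fun M : Matrix (Fin n) (Fin n) ℂ => Γᴴ * M * Cᴴ := by fun_prop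
  exact ((continuousOn_id.smul (c1.comp_continuousOn h1)).add continuousOn_const).add
    (c2.comp_continuousOn h2)

/-- `𝒳_Φ = {x ∈ ℂⁿ | W_obs x ∈ Im T_Φ^*}`. -/
def stateSpace {r m n : ℕ} (Φ : ℂ → Matrix (Fin r) (Fin m) ℂ) (C : Matrix (Fin m) (Fin n) ℂ)
    {A : Matrix (Fin n) (Fin n) ℂ} (hA : IsStable A) : Submodule ℂ (Vec n) :=
  (LinearMap.range (toeplitz Φ).adjoint.toLinearMap).comap (obsOp C hA).toLinearMap

/-- `C_Φ` is an output matrix of `Φ`: `Φ(z) = Φ(0) + z C_Φ (I - z A)⁻¹ Γ`, and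
`W_obs x = T_Φ^* W_{Φ,obs} x` for `x ∈ 𝒳_Φ`, where `W_{Φ,obs}` is the observability operator of
`{C_Φ, A}`. -/
structure IsOutputMatrix {r m n : ℕ} (Φ : ℂ → Matrix (Fin r) (Fin m) ℂ)
    (C : Matrix (Fin m) (Fin n) ℂ) (Γ : Matrix (Fin n) (Fin m) ℂ)
    {A : Matrix (Fin n) (Fin n) ℂ} (hA : IsStable A) (CΦ : Matrix (Fin r) (Fin n) ℂ) : Prop where
  realization : RatEq Φ (fun z => Φ 0 + z • (CΦ * (1 - z • A)⁻¹ * Γ))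
  intertwining : ∀ x ∈ stateSpace Φ C hA,
    obsOp C hA x = (toeplitz Φ).adjoint (obsOp CΦ hA x)

open scoped MatrixOrder in
/-- The nonnegative square root of a nonnegative matrix. -/
def psdSqrt {m : ℕ} (M : Matrix (Fin m) (Fin m) ℂ) : Matrix (Fin m) (Fin m) ℂ :=
  CFC.sqrt M

end OuterFactor

end

noncomputable section

namespace OuterFactor

/-! ### Matrices as operators -/

/-! Write `T` for `toeplitz Φ`, `E` for `firstEmb` and `B` for `backShift`. A power series symbol
maps Hardy space to Hardy space, so the factorization of `R` gives `T_R = T* T` (`toeplitz_eq`).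
Positivity of `R` on the circle makes `R⁻¹ Φ*` a bounded left inverse of multiplication by `Φ`.
Hence `T` is bounded below and, having dense range, invertible; so is `T_R`, and `T*` is onto, which
makes the state space everything.

Block lower triangularity of `T` gives `T* E = E Φ(0)*` and `B T* = T* B`. These two relations force
`Φ(0)*` to be bijective (`bijective_adjoint_coeff_zero`), whence `r = m`. They also show that
`T^{-*} W_obs` intertwines `A` with `B`, and any such operator is the observability operator of its
first entry (`eq_obsOp`). This leaves only one candidate for `C_Φ`.

The candidate realizes `Φ` because the first column of `T_R` below its top entry is `W_obs Γ`:
cancelling `T*` gives `B T E = W_{Φ,obs} Γ`, that is, the Taylor coefficients of `Φ` are `C_Φ A^j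
Γ`.

The explicit formulas come from inserting `E E* + B* B = I` (`adjoint_comp_eq_decomp`) into two
products. From `R₀ = (T E)* (T E)` one gets `R₀ - Γ* Q Γ = Φ(0)* Φ(0)`, and from `C = (T E)*
W_{Φ,obs}` one gets `C - Γ* Q A = Φ(0)* C_Φ`. Since `Φ(0)` is invertible, positivity and the formula
for `C_Φ` follow, and the normalizing unitary is the one in the polar decomposition of `Φ(0)`. -/

theorem matOp_mul {k l p : ℕ} (M : Matrix (Fin k) (Fin l) ℂ) (N : Matrix (Fin l) (Fin p) ℂ) :
    matOp (M * N) = matOp M ∘L matOp N := by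
  ext1 x
  simp only [matOp, LinearMap.coe_toContinuousLinearMap', Matrix.toLpLin_apply,
    ContinuousLinearMap.comp_apply]
  rw [← Matrix.mulVec_mulVec]

theorem matOp_one (k : ℕ) : matOp (1 : Matrix (Fin k) (Fin k) ℂ) = .id ℂ _ := by
  ext1 x
  simp [matOp]

/-- `matOp` as a linear equivalence. -/
def matOpEquiv (k l : ℕ) : Matrix (Fin k) (Fin l) ℂ ≃ₗ[ℂ] (Vec l →L[ℂ] Vec k) :=
  Matrix.toEuclideanLin.trans LinearMap.toContinuousLinearMap

theorem matOp_add {k l : ℕ} (M N : Matrix (Fin k) (Fin l) ℂ) :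
    matOp (M + N) = matOp M + matOp N := map_add (matOpEquiv k l) M N

theorem matOp_sub {k l : ℕ} (M N : Matrix (Fin k) (Fin l) ℂ) :
    matOp (M - N) = matOp M - matOp N := map_sub (matOpEquiv k l) M N

theorem matOp_smul {k l : ℕ} (c : ℂ) (M : Matrix (Fin k) (Fin l) ℂ) :
    matOp (c • M) = c • matOp M := map_smul (matOpEquiv k l) c M

theorem matOp_injective {k l : ℕ} :
    Function.Injective (matOp : Matrix (Fin k) (Fin l) ℂ → _) := (matOpEquiv k l).injective

theorem matOp_surjective {k l : ℕ} :
    Function.Surjective (matOp : Matrix (Fin k) (Fin l) ℂ → _) := (matOpEquiv k l).surjective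

theorem continuous_matOp {k l : ℕ} :
    Continuous (matOp : Matrix (Fin k) (Fin l) ℂ → _) :=
  LinearMap.continuous_of_finiteDimensional (matOpEquiv k l).toLinearMap

theorem matOp_conjTranspose {k l : ℕ} (M : Matrix (Fin k) (Fin l) ℂ) :
    matOp Mᴴ = (matOp M).adjoint := by
  rw [matOp, matOp, ← LinearMap.adjoint_toContinuousLinearMap,
    Matrix.toEuclideanLin_conjTranspose_eq_adjoint]

/-! ### Multiplication operators -/

theorem norm_toCircle (t : UnitAddCircle) : ‖(AddCircle.toCircle t : ℂ)‖ = 1 := Circle.norm_coe _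

theorem toCircle_mem_sphere (t : UnitAddCircle) :
    (AddCircle.toCircle t : ℂ) ∈ Metric.sphere (0 : ℂ) 1 := by
  rw [mem_sphere_zero_iff_norm, norm_toCircle]

theorem paraConj_toCircle {k l : ℕ} (Ω : ℂ → Matrix (Fin k) (Fin l) ℂ) (t : UnitAddCircle) :
    paraConj Ω (AddCircle.toCircle t) = (Ω (AddCircle.toCircle t))ᴴ := by
  rw [paraConj, ← Circle.coe_inv_eq_conj, ← Circle.coe_inv, inv_inv]

theorem continuousOn_paraConj {k l : ℕ} {Ω : ℂ → Matrix (Fin k) (Fin l) ℂ}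
    (hΩ : ContinuousOn Ω (Metric.sphere 0 1)) : ContinuousOn (paraConj Ω) (Metric.sphere 0 1) := by
  have h : ContinuousOn (fun z => (Ω z)ᴴ) (Metric.sphere 0 1) :=
    (continuous_id.matrix_conjTranspose).comp_continuousOn hΩ
  refine h.congr fun z hz => ?_
  have hz1 : ‖z‖ = 1 := mem_sphere_zero_iff_norm.mp hz
  rw [paraConj, ← Complex.inv_eq_conj hz1, inv_inv]

/-- Reduces identities between multiplication operators to pointwise matrix identities on the
circle. -/
theorem mulOp_coeFn {k l : ℕ} {Ω : ℂ → Matrix (Fin k) (Fin l) ℂ}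
    (hΩ : ContinuousOn Ω (Metric.sphere 0 1)) (f : L2Circle l) :
    mulOp Ω f =ᵐ[circleMeasure] fun t => boundary Ω t (f t) := by
  have hs : symbolLp Ω =ᵐ[circleMeasure] boundary Ω := by
    rw [symbolLp, dif_pos (memLp_boundary hΩ)]; exact (memLp_boundary hΩ).coeFn_toLp
  have hm : mulOp Ω f =ᵐ[circleMeasure] fun t => symbolLp Ω t (f t) :=
    ContinuousLinearMap.coeFn_holder (r := 2) (ContinuousLinearMap.id ℂ (Vec l →L[ℂ] Vec k))
      (symbolLp Ω) f
  filter_upwards [hs, hm] with t h1 h2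
  rw [h2, h1]

theorem nullSingletonClass_circleMeasure : NullSingletonClass circleMeasure := by
  have : Fact ((0 : ℝ) < 0 + 1) := ⟨by norm_num⟩
  have : Nontrivial UnitAddCircle := by
    have : Nontrivial (Set.Ico (0 : ℝ) (0 + 1)) :=
      Set.nontrivial_coe_sort.mpr ⟨0, by norm_num, 1 / 2, by norm_num, by norm_num⟩
    exact (AddCircle.equivIco (1 : ℝ) 0).nontrivial
  have : (nhdsWithin (0 : UnitAddCircle) {0}ᶜ).NeBot := inferInstance
  infer_instance

/-- The circle parametrization is injective, so a finite exceptional set in `ℂ` pulls back to a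
finite set, which is null because Haar measure has no atoms. Thus rational equality is enough for
equality of Toeplitz operators. -/
theorem RatEq.boundary_ae_eq {k l : ℕ} {Ω Ψ : ℂ → Matrix (Fin k) (Fin l) ℂ} (h : RatEq Ω Ψ) :
    boundary Ω =ᵐ[circleMeasure] boundary Ψ := by
  have hinj : Function.Injective fun t : UnitAddCircle => (AddCircle.toCircle t : ℂ) :=
    Subtype.val_injective.comp (AddCircle.injective_toCircle one_ne_zero)
  have hfin : {t : UnitAddCircle | ¬ Ω (AddCircle.toCircle t : ℂ) = Ψ (AddCircle.toCircle t)}.Finite :=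
    Set.Finite.preimage hinj.injOn h
  have := nullSingletonClass_circleMeasure
  have h0 : circleMeasure
      {t : UnitAddCircle | ¬ Ω (AddCircle.toCircle t : ℂ) = Ψ (AddCircle.toCircle t)} = 0 :=
    hfin.measure_zero _
  filter_upwards [ae_iff.mpr h0] with t ht
  rw [boundary, boundary, ht]

theorem mulOp_congr {k l : ℕ} {Ω Ψ : ℂ → Matrix (Fin k) (Fin l) ℂ}
    (hΩ : ContinuousOn Ω (Metric.sphere 0 1)) (hΨ : ContinuousOn Ψ (Metric.sphere 0 1))
    (h : boundary Ω =ᵐ[circleMeasure] boundary Ψ) : mulOp Ω = mulOp Ψ := by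
  ext1 f
  apply Lp.ext
  filter_upwards [mulOp_coeFn hΩ f, mulOp_coeFn hΨ f, h] with t h1 h2 h3
  rw [h1, h2, h3]

theorem continuousOn_matrix_mul {k l p : ℕ} {F : ℂ → Matrix (Fin k) (Fin l) ℂ}
    {G : ℂ → Matrix (Fin l) (Fin p) ℂ} {s : Set ℂ} (hF : ContinuousOn F s)
    (hG : ContinuousOn G s) : ContinuousOn (fun z => F z * G z) s := by
  rw [continuousOn_iff_continuous_domRestrict] at hF hG ⊢
  exact hF.matrix_mul hG

theorem mulOp_mul {k l p : ℕ} {Ω : ℂ → Matrix (Fin k) (Fin l) ℂ}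
    {Ψ : ℂ → Matrix (Fin l) (Fin p) ℂ}
    (hΩ : ContinuousOn Ω (Metric.sphere 0 1)) (hΨ : ContinuousOn Ψ (Metric.sphere 0 1)) :
    mulOp (fun z => Ω z * Ψ z) = mulOp Ω ∘L mulOp Ψ := by
  ext1 f
  apply Lp.ext
  have hc : ContinuousOn (fun z => Ω z * Ψ z) (Metric.sphere 0 1) :=
    continuousOn_matrix_mul hΩ hΨ
  filter_upwards [mulOp_coeFn hc f, mulOp_coeFn hΩ (mulOp Ψ f), mulOp_coeFn hΨ f] with t h1 h2 h3
  rw [h1, ContinuousLinearMap.comp_apply, h2, h3, boundary, matOp_mul]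
  rfl

theorem mulOp_add {k l : ℕ} {Ω Ψ : ℂ → Matrix (Fin k) (Fin l) ℂ}
    (hΩ : ContinuousOn Ω (Metric.sphere 0 1)) (hΨ : ContinuousOn Ψ (Metric.sphere 0 1)) :
    mulOp (fun z => Ω z + Ψ z) = mulOp Ω + mulOp Ψ := by
  ext1 f
  apply Lp.ext
  rw [add_apply]
  filter_upwards [mulOp_coeFn (hΩ.add hΨ) f, mulOp_coeFn hΩ f, mulOp_coeFn hΨ f,
    Lp.coeFn_add (mulOp Ω f) (mulOp Ψ f)] with t h1 h2 h3 h4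
  rw [h4, Pi.add_apply, h2, h3]
  refine h1.trans ?_
  exact congrArg (· (f t)) (matOp_add (Ω (AddCircle.toCircle t)) (Ψ (AddCircle.toCircle t)))

theorem mulOp_one (k : ℕ) :
    mulOp (fun _ => (1 : Matrix (Fin k) (Fin k) ℂ)) = .id ℂ _ := by
  ext1 f
  apply Lp.ext
  filter_upwards [mulOp_coeFn continuousOn_const f] with t h1
  rw [h1, boundary, matOp_one]
  rfl

theorem mulOp_paraConj {k l : ℕ} {Ω : ℂ → Matrix (Fin k) (Fin l) ℂ}
    (hΩ : ContinuousOn Ω (Metric.sphere 0 1)) : mulOp (paraConj Ω) = (mulOp Ω).adjoint := by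
  rw [ContinuousLinearMap.eq_adjoint_iff]
  intro f g
  rw [L2.inner_def, L2.inner_def]
  apply integral_congr_ae
  filter_upwards [mulOp_coeFn (continuousOn_paraConj hΩ) f, mulOp_coeFn hΩ g] with t h1 h2
  rw [h1, h2, boundary, paraConj_toCircle, matOp_conjTranspose,
    ContinuousLinearMap.adjoint_inner_left]
  rfl

/-! ### Toeplitz operators of general symbols -/

theorem toeplitz_congr {k l : ℕ} {Ω Ψ : ℂ → Matrix (Fin k) (Fin l) ℂ}
    (hΩ : ContinuousOn Ω (Metric.sphere 0 1)) (hΨ : ContinuousOn Ψ (Metric.sphere 0 1))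
    (h : boundary Ω =ᵐ[circleMeasure] boundary Ψ) : toeplitz Ω = toeplitz Ψ := by
  rw [toeplitz, mulOp_congr hΩ hΨ h, toeplitz]

theorem toeplitz_add {k l : ℕ} {Ω Ψ : ℂ → Matrix (Fin k) (Fin l) ℂ}
    (hΩ : ContinuousOn Ω (Metric.sphere 0 1)) (hΨ : ContinuousOn Ψ (Metric.sphere 0 1)) :
    toeplitz (fun z => Ω z + Ψ z) = toeplitz Ω + toeplitz Ψ := by
  rw [toeplitz, mulOp_add hΩ hΨ, toeplitz, toeplitz, ContinuousLinearMap.add_comp,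
    ContinuousLinearMap.comp_add]

theorem toeplitz_paraConj {k l : ℕ} {Ω : ℂ → Matrix (Fin k) (Fin l) ℂ}
    (hΩ : ContinuousOn Ω (Metric.sphere 0 1)) : toeplitz (paraConj Ω) = (toeplitz Ω).adjoint := by
  rw [toeplitz, toeplitz, mulOp_paraConj hΩ, ContinuousLinearMap.adjoint_comp,
    ContinuousLinearMap.adjoint_comp, ContinuousLinearMap.adjoint_adjoint,
    ContinuousLinearMap.comp_assoc]

theorem adjoint_hardyEmb_comp (k : ℕ) :
    (hardyEmb k).toContinuousLinearMap.adjoint ∘L (hardyEmb k).toContinuousLinearMap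
      = .id ℂ _ := (hardyEmb k).adjoint_comp_self

theorem toeplitz_one (k : ℕ) :
    toeplitz (fun _ => (1 : Matrix (Fin k) (Fin k) ℂ)) = .id ℂ _ := by
  rw [toeplitz, mulOp_one, ContinuousLinearMap.id_comp, adjoint_hardyEmb_comp]

/-! ### The backward shift -/

/-- Every sequence is the norm-convergent sum of its one-entry pieces. -/
theorem lp_ext {k : ℕ} {F : Type*} [NormedAddCommGroup F] [NormedSpace ℂ F]
    {S T : SeqSpace k →L[ℂ] F}
    (h : ∀ (j : ℕ) (u : Vec k), S (lp.single 2 j u) = T (lp.single 2 j u)) : S = T := by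
  ext1 f
  have hf := lp.hasSum_single (p := 2) (by norm_num) f
  refine (hf.mapL S).unique ?_
  simpa only [h] using hf.mapL T

theorem inner_single {k : ℕ} (j : ℕ) (u : Vec k) (f : SeqSpace k) :
    inner ℂ (lp.single 2 j u : SeqSpace k) f = inner ℂ u (f j) :=
  lp.inner_single_left j u f

theorem memℓp_shift {k : ℕ} (f : SeqSpace k) : Memℓp (fun i => f (i + 1)) 2 := by
  have h := lp.memℓp f
  rw [memℓp_gen_iff (by norm_num)] at h ⊢
  exact (summable_nat_add_iff 1).mpr h

/-- The linear map underlying the backward shift. -/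
def backShiftLM (k : ℕ) : SeqSpace k →ₗ[ℂ] SeqSpace k where
  toFun f := ⟨fun i => f (i + 1), memℓp_shift f⟩
  map_add' f g := by ext1; rfl
  map_smul' c f := by ext1; rfl

/-- Splits the zeroth term off the inner product series. Stated for the bare linear map because the
norm bound for `backShift` is derived from it. -/
theorem inner_eq_add_backShiftLM {k : ℕ} (f g : SeqSpace k) :
    inner ℂ f g = inner ℂ (f 0) (g 0) + inner ℂ (backShiftLM k f) (backShiftLM k g) := by
  have h := (lp.summable_inner (𝕜 := ℂ) f g).tsum_eq_zero_add
  rw [← lp.inner_eq_tsum] at h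
  rw [h, lp.inner_eq_tsum (backShiftLM k f)]
  rfl

/-- The backward shift `(f₀, f₁, …) ↦ (f₁, f₂, …)`. -/
def backShift (k : ℕ) : SeqSpace k →L[ℂ] SeqSpace k :=
  (backShiftLM k).mkContinuous 1 fun f => by
    have h := inner_eq_add_backShiftLM f f
    simp only [inner_self_eq_norm_sq_to_K] at h
    have h' : ‖f‖ ^ 2 = ‖f 0‖ ^ 2 + ‖backShiftLM k f‖ ^ 2 := by exact_mod_cast h
    rw [one_mul]
    refine abs_le_of_sq_le_sq' ?_ (norm_nonneg _) |>.2
    nlinarith [sq_nonneg ‖f 0‖]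

theorem backShift_apply {k : ℕ} (f : SeqSpace k) (i : ℕ) : backShift k f i = f (i + 1) := rfl

theorem firstEmb_apply {k : ℕ} (u : Vec k) : firstEmb k u = lp.single 2 0 u := rfl

theorem adjoint_firstEmb_apply {k : ℕ} (f : SeqSpace k) : (firstEmb k).adjoint f = f 0 := by
  refine ext_inner_left ℂ fun v => ?_
  rw [ContinuousLinearMap.adjoint_inner_right]
  exact inner_single 0 v f

theorem firstEmb_backShift_decomp (k : ℕ) :
    firstEmb k ∘L (firstEmb k).adjoint + (backShift k).adjoint ∘L backShift k = .id ℂ _ := by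
  ext1 f
  refine ext_inner_left ℂ fun g => ?_
  rw [add_apply, inner_add_right, ContinuousLinearMap.comp_apply, ContinuousLinearMap.comp_apply,
    ContinuousLinearMap.adjoint_inner_right, ← ContinuousLinearMap.adjoint_inner_left,
    adjoint_firstEmb_apply, adjoint_firstEmb_apply]
  exact (inner_eq_add_backShiftLM g f).symm

theorem backShift_single_succ {k : ℕ} (j : ℕ) (u : Vec k) :
    backShift k (lp.single 2 (j + 1) u) = lp.single 2 j u := by
  ext1; funext i
  rw [backShift_apply, lp.single_apply, lp.single_apply]
  by_cases h : i = j
  · subst h; simp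
  · rw [Pi.single_eq_of_ne (by omega), Pi.single_eq_of_ne h]

/-! ### Toeplitz operators of analytic symbols -/

/-- The operator valued boundary function of `Ω` is the sum of an absolutely convergent power
series with coefficients `φ`. -/
structure HasAnalyticSeries {k l : ℕ} (Ω : ℂ → Matrix (Fin k) (Fin l) ℂ)
    (φ : ℕ → Vec l →L[ℂ] Vec k) : Prop where
  continuousOn : ContinuousOn Ω (Metric.sphere 0 1)
  summable : Summable fun j => ‖φ j‖
  hasSum : ∀ z : ℂ, ‖z‖ ≤ 1 → HasSum (fun j => z ^ j • φ j) (matOp (Ω z))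

namespace HasAnalyticSeries

variable {k l : ℕ} {Ω : ℂ → Matrix (Fin k) (Fin l) ℂ} {φ : ℕ → Vec l →L[ℂ] Vec k}

theorem summable_apply (h : HasAnalyticSeries Ω φ) (u : Vec l) :
    Summable fun i => ‖φ i u‖ :=
  Summable.of_nonneg_of_le (fun _ => norm_nonneg _) (fun i => (φ i).le_opNorm u)
    (h.summable.mul_right _)

theorem coeff_zero (h : HasAnalyticSeries Ω φ) : φ 0 = matOp (Ω 0) := by
  refine HasSum.unique ?_ (h.hasSum 0 (by simp))
  convert hasSum_single (f := fun j => (0 : ℂ) ^ j • φ j) 0 ?_ using 1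
  · simp
  · intro j hj; rw [zero_pow hj]; exact zero_smul ℂ (φ j)

/-- Absolute summability makes the series converge uniformly on the circle; the continuous inclusion
of `C(𝕋)` in `L²` then carries the sum over. -/
theorem hasSum_mulOp (h : HasAnalyticSeries Ω φ) (j : ℕ) (u : Vec l) :
    HasSum (fun i => monomialEmb k (i + j) (φ i u)) (mulOp Ω (monomialEmb l j u)) := by
  let g : ℕ → C(UnitAddCircle, Vec k) := fun i =>
    ⟨fun t => fourier ((i + j : ℕ) : ℤ) t • φ i u, by fun_prop⟩
  have hg : Summable g := by
    refine Summable.of_norm_bounded (h.summable_apply u) fun i => ?_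
    rw [ContinuousMap.norm_le _ (norm_nonneg _)]
    intro t
    change ‖fourier ((i + j : ℕ) : ℤ) t • φ i u‖ ≤ _
    rw [norm_smul, fourier_apply, Circle.norm_coe, one_mul]
  have hgs := hg.hasSum.mapL (ContinuousMap.toLp (E := Vec k) 2 circleMeasure ℂ)
  have key : ContinuousMap.toLp (E := Vec k) 2 circleMeasure ℂ (∑' i, g i)
      = mulOp Ω (monomialEmb l j u) := by
    apply Lp.ext
    filter_upwards [ContinuousMap.coeFn_toLp (p := 2) (𝕜 := ℂ) circleMeasure (∑' i, g i),
      mulOp_coeFn h.continuousOn (monomialEmb l j u), coeFn_monomialEmb l j u] with t h1 h2 h3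
    rw [h1, h2, h3]
    have e1 : HasSum (fun i => g i t) ((∑' i, g i) t) :=
      hg.hasSum.mapL (ContinuousMap.evalCLM ℂ t)
    refine e1.unique ?_
    have e2 := ((h.hasSum _ (norm_toCircle t).le).mapL
      (ContinuousLinearMap.apply ℂ (Vec k) u)).const_smul (fourier (j : ℤ) t)
    rw [map_smul]
    have e3 : (fun i => g i t) = fun i => fourier (j : ℤ) t •
        ContinuousLinearMap.apply ℂ (Vec k) u ((AddCircle.toCircle t : ℂ) ^ i • φ i) := by
      funext i
      change fourier ((i + j : ℕ) : ℤ) t • φ i u = _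
      rw [Nat.cast_add, fourier_add, mul_comm, mul_smul]
      simp [fourier_apply, AddCircle.toCircle_nsmul]
    rw [e3]
    exact e2
  rw [← key]
  exact hgs

theorem hasSum_single (h : HasAnalyticSeries Ω φ) (j : ℕ) (u : Vec l) :
    HasSum (fun i => lp.single 2 (i + j) (φ i u)) (toeplitz Ω (lp.single 2 j u)) := by
  have h1 := (h.hasSum_mulOp j u).mapL (hardyEmb k).toContinuousLinearMap.adjoint
  have e2 : (hardyEmb l).toContinuousLinearMap (lp.single 2 j u) = monomialEmb l j u :=
    (orthogonalFamily_monomialEmb l).linearIsometry_apply_single u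
  have e3 : ∀ i (v : Vec k), (hardyEmb k).toContinuousLinearMap.adjoint (monomialEmb k i v)
      = lp.single 2 i v := fun i v => by
    have : monomialEmb k i v = (hardyEmb k).toContinuousLinearMap (lp.single 2 i v) :=
      ((orthogonalFamily_monomialEmb k).linearIsometry_apply_single v).symm
    rw [this]
    exact DFunLike.congr_fun (adjoint_hardyEmb_comp k) _
  simp only [e3] at h1
  rwa [toeplitz, ContinuousLinearMap.comp_apply, ContinuousLinearMap.comp_apply, e2]

/-- Multiplication by an analytic symbol leaves Hardy space invariant, so compressing to it loses
nothing. -/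
theorem hardyEmb_comp_toeplitz (h : HasAnalyticSeries Ω φ) :
    (hardyEmb k).toContinuousLinearMap ∘L toeplitz Ω
      = mulOp Ω ∘L (hardyEmb l).toContinuousLinearMap := by
  refine lp_ext fun j u => ?_
  refine ((h.hasSum_single j u).mapL (hardyEmb k).toContinuousLinearMap).unique ?_
  have e2 : ∀ k i v, (hardyEmb k).toContinuousLinearMap (lp.single 2 i v) = monomialEmb k i v :=
    fun k i v => (orthogonalFamily_monomialEmb k).linearIsometry_apply_single v
  simpa only [e2, ContinuousLinearMap.comp_apply] using h.hasSum_mulOp j u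

/-- Only the right factor has to be analytic; this lets the left one be `paraConj Φ` in `R = Φ* Φ`.
-/
theorem toeplitz_mul {p : ℕ} {Ψ : ℂ → Matrix (Fin p) (Fin k) ℂ}
    (hΨ : ContinuousOn Ψ (Metric.sphere 0 1)) (h : HasAnalyticSeries Ω φ) :
    toeplitz (fun z => Ψ z * Ω z) = toeplitz Ψ ∘L toeplitz Ω := by
  rw [toeplitz, mulOp_mul hΨ h.continuousOn, ContinuousLinearMap.comp_assoc,
    ← h.hardyEmb_comp_toeplitz, toeplitz]
  rfl

theorem toeplitz_single_zero_apply (h : HasAnalyticSeries Ω φ) (u : Vec l) (i : ℕ) :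
    toeplitz Ω (lp.single 2 0 u) i = φ i u := by
  have h1 := (h.hasSum_single 0 u).mapL (lp.evalCLM ℂ (fun _ : ℕ => Vec k) 2 i)
  refine HasSum.unique h1 ?_
  convert _root_.hasSum_single i ?_ using 1
  · exact (lp.single_apply_self (E := fun _ : ℕ => Vec k) 2 i (φ i u)).symm
  · intro b hb
    exact lp.single_apply_ne (E := fun _ : ℕ => Vec k) 2 b (φ b u) hb.symm

/-- The block matrix is lower triangular, so its top row has a single nonzero entry. -/
theorem adjoint_firstEmb_comp_toeplitz (h : HasAnalyticSeries Ω φ) :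
    (firstEmb k).adjoint ∘L toeplitz Ω = φ 0 ∘L (firstEmb l).adjoint := by
  refine lp_ext fun j u => ?_
  have h1 := (h.hasSum_single j u).mapL (firstEmb k).adjoint
  rw [ContinuousLinearMap.comp_apply, ContinuousLinearMap.comp_apply]
  refine h1.unique ?_
  simp only [adjoint_firstEmb_apply]
  rcases j with _ | j
  · convert _root_.hasSum_single 0 ?_ using 1
    · simp [lp.single_apply]
    · intro b hb
      exact lp.single_apply_ne (E := fun _ : ℕ => Vec k) 2 b (φ b u) hb.symm
  · have e : (lp.single 2 (j + 1) u : SeqSpace l) 0 = 0 :=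
      lp.single_apply_ne (E := fun _ : ℕ => Vec l) 2 (j + 1) u (by omega)
    rw [e, map_zero]
    convert hasSum_zero with b
    exact lp.single_apply_ne (E := fun _ : ℕ => Vec k) 2 (b + (j + 1)) (φ b u) (by omega)

theorem backShift_toeplitz_single_succ (h : HasAnalyticSeries Ω φ) (j : ℕ) (u : Vec l) :
    backShift k (toeplitz Ω (lp.single 2 (j + 1) u)) = toeplitz Ω (lp.single 2 j u) := by
  have h1 := (h.hasSum_single (j + 1) u).mapL (backShift k)
  refine h1.unique ?_
  simpa only [← add_assoc, backShift_single_succ] using h.hasSum_single j u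

/-- Dual to the fact that an analytic Toeplitz operator commutes with the forward shift; tested
against one-entry sequences, whose images vanish at index `0` once shifted. -/
theorem backShift_comp_adjoint_toeplitz (h : HasAnalyticSeries Ω φ) :
    backShift l ∘L (toeplitz Ω).adjoint = (toeplitz Ω).adjoint ∘L backShift k := by
  ext1 f
  apply lp.ext
  funext j
  refine ext_inner_left ℂ fun u => ?_
  rw [ContinuousLinearMap.comp_apply, ContinuousLinearMap.comp_apply, backShift_apply]
  refine (inner_single (j + 1) u _).symm.trans (Eq.trans ?_ (inner_single j u _))
  rw [ContinuousLinearMap.adjoint_inner_right, ContinuousLinearMap.adjoint_inner_right,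
    inner_eq_add_backShiftLM]
  have e0 : toeplitz Ω (lp.single 2 (j + 1) u) 0 = 0 := by
    have := DFunLike.congr_fun h.adjoint_firstEmb_comp_toeplitz (lp.single 2 (j + 1) u)
    rw [ContinuousLinearMap.comp_apply, ContinuousLinearMap.comp_apply, adjoint_firstEmb_apply,
      adjoint_firstEmb_apply] at this
    rw [this, lp.single_apply_ne (E := fun _ : ℕ => Vec l) 2 (j + 1) u (by omega), map_zero]
  rw [e0, inner_zero_left, zero_add]
  exact congrArg (inner ℂ · (backShift k f)) (h.backShift_toeplitz_single_succ j u)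

end HasAnalyticSeries

/-! ### Power series of rational functions -/

/-- Radius of convergence greater than one gives absolute convergence on the closed unit disc. -/
theorem exists_summable_series {F : Type*} [NormedAddCommGroup F] [NormedSpace ℂ F]
    [CompleteSpace F] {f : ℂ → F} {ρ : ℝ} (hρ : 1 < ρ)
    (hf : DifferentiableOn ℂ f (Metric.closedBall 0 ρ)) :
    ∃ φ : ℕ → F, (Summable fun j => ‖φ j‖) ∧
      ∀ z : ℂ, ‖z‖ ≤ 1 → HasSum (fun j => z ^ j • φ j) (f z) := by
  lift ρ to NNReal using by linarith
  have hρ1 : (1 : NNReal) < ρ := by exact_mod_cast hρ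
  have hs := hf.hasFPowerSeriesOnBall (zero_lt_one.trans hρ1)
  set p := cauchyPowerSeries f 0 ρ
  refine ⟨fun j => p.coeff j, ?_, fun z hz => ?_⟩
  · have h1 : ((1 : NNReal) : ℝ≥0∞) < p.radius :=
      lt_of_lt_of_le (by exact_mod_cast hρ1) hs.r_le
    simpa using p.summable_norm_mul_pow h1
  · have hz' : z ∈ Metric.eball (0 : ℂ) ρ := by
      rw [Metric.mem_eball, edist_zero_right, enorm_eq_nnnorm]
      exact_mod_cast lt_of_le_of_lt (show ‖z‖₊ ≤ 1 from hz) hρ1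
    simpa using hs.hasSum hz'

theorem IsStableRational.exists_hasAnalyticSeries {k l : ℕ} {Ω : ℂ → Matrix (Fin k) (Fin l) ℂ}
    (hΩ : IsStableRational Ω) : ∃ φ, HasAnalyticSeries Ω φ := by
  have hc := hΩ.continuousOn_sphere
  obtain ⟨P, q, hq, h⟩ := hΩ
  have hU : IsOpen {z : ℂ | q.eval z ≠ 0} := isOpen_ne_fun q.continuous continuous_const
  -- By compactness, the zero-free region of `q` contains a closed disc of radius `1 + δ`.
  obtain ⟨δ, hδ, hsub⟩ := (isCompact_closedBall (0 : ℂ) 1).exists_cthickening_subset_open hU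
    fun z hz => hq z (mem_closedBall_zero_iff.mp hz)
  rw [cthickening_closedBall hδ.le zero_le_one] at hsub
  have hd : DifferentiableOn ℂ (fun z => matOp (Ω z)) (Metric.closedBall 0 (δ + 1)) := by
    have h1 : DifferentiableOn ℂ (fun z => (q.eval z)⁻¹ • matOp (P.map (Polynomial.eval z)))
        (Metric.closedBall 0 (δ + 1)) := by
      refine (q.differentiable.differentiableOn.inv fun z hz => hsub hz).smul
        (Differentiable.differentiableOn ?_)
      have h2 : Differentiable ℂ fun z => fun i j => (P i j).eval z :=
        differentiable_pi.mpr fun i => differentiable_pi.mpr fun j => (P i j).differentiable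
      let e : (Fin k → Fin l → ℂ) →L[ℂ] (Vec l →L[ℂ] Vec k) :=
        ⟨(matOpEquiv k l).toLinearMap, continuous_matOp⟩
      have h3 : Differentiable ℂ fun z => e (fun i j => (P i j).eval z) :=
        e.differentiable.comp h2
      exact h3
    refine h1.congr fun z hz => ?_
    rw [h z (hsub hz), matOp_smul]
  obtain ⟨φ, hφ, hs⟩ := exists_summable_series (by linarith) hd
  exact ⟨φ, hc, hφ, hs⟩

theorem IsStableRational.const {k l : ℕ} (M : Matrix (Fin k) (Fin l) ℂ) :
    IsStableRational fun _ => M :=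
  ⟨M.map Polynomial.C, 1, by simp, fun z _ => by ext i j; simp⟩

theorem IsStableRational.const_mul {p k l : ℕ} {Ω : ℂ → Matrix (Fin k) (Fin l) ℂ}
    (M : Matrix (Fin p) (Fin k) ℂ) (hΩ : IsStableRational Ω) :
    IsStableRational fun z => M * Ω z := by
  obtain ⟨P, q, hq, h⟩ := hΩ
  refine ⟨M.map Polynomial.C * P, q, hq, fun z hz => ?_⟩
  have e : (M.map Polynomial.C * P).map (Polynomial.eval z) = M * P.map (Polynomial.eval z) := by
    ext i j
    simp [Matrix.mul_apply, Polynomial.eval_finsetSum]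
  change M * Ω z = _
  rw [e, h z hz, Matrix.mul_smul]

/-- Two stable rational functions that agree on the unit circle agree as rational functions. -/
theorem IsStableRational.ratEq {k l : ℕ} {Ω Ψ : ℂ → Matrix (Fin k) (Fin l) ℂ}
    (hΩ : IsStableRational Ω) (hΨ : IsStableRational Ψ)
    (h : ∀ z : ℂ, ‖z‖ = 1 → Ω z = Ψ z) : RatEq Ω Ψ := by
  obtain ⟨P, q, hq, hP⟩ := hΩ
  obtain ⟨P', q', hq', hP'⟩ := hΨ
  have hinf : {z : ℂ | ‖z‖ = 1}.Infinite := by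
    have : Function.Injective fun t : UnitAddCircle => (AddCircle.toCircle t : ℂ) :=
      Subtype.val_injective.comp (AddCircle.injective_toCircle one_ne_zero)
    have hI : Infinite UnitAddCircle := by
      have : Fact ((0 : ℝ) < 1) := ⟨one_pos⟩
      have : Infinite (Set.Ico (0 : ℝ) (0 + 1)) :=
        Set.infinite_coe_iff.mpr (Set.Ico_infinite (by norm_num))
      exact (AddCircle.equivIco (1 : ℝ) 0).infinite_iff.mpr this
    refine (Set.infinite_range_of_injective this).mono ?_
    rintro _ ⟨t, rfl⟩
    exact norm_toCircle t
  -- Cross-multiplied numerators agree on the infinite unit circle, hence as polynomials.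
  have hpoly : ∀ i j, q' * P i j = q * P' i j := fun i j => by
    refine Polynomial.eq_of_infinite_eval_eq _ _ (hinf.mono fun z hz => ?_)
    have hz' : ‖z‖ = 1 := hz
    have h1 := hq z hz'.le
    have h2 := hq' z hz'.le
    have h3 := congrFun (congrFun (h z hz') i) j
    rw [hP z h1, hP' z h2] at h3
    simp only [Matrix.smul_apply, Matrix.map_apply, smul_eq_mul] at h3
    simp only [Set.mem_ofPred_eq, Polynomial.eval_mul]
    field_simp at h3
    linear_combination h3
  have hne : q * q' ≠ 0 := fun h0 => by
    have := congrArg (Polynomial.eval 0) h0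
    simp [hq 0 (by simp), hq' 0 (by simp)] at this
  -- Values are unspecified where a denominator vanishes, so the exceptional set lies among the
  -- roots of `q * q'`.
  refine ((q * q').roots.toFinset.finite_toSet.subset fun z hz => ?_)
  rw [Finset.mem_coe, Multiset.mem_toFinset, Polynomial.mem_roots hne, Polynomial.IsRoot]
  by_contra h0
  rw [Polynomial.eval_mul, mul_eq_zero, not_or] at h0
  refine hz ?_
  change Ω z = Ψ z
  rw [hP z h0.1, hP' z h0.2]
  ext i j
  have := congrArg (Polynomial.eval z) (hpoly i j)
  simp only [Polynomial.eval_mul] at this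
  simp only [Matrix.smul_apply, Matrix.map_apply, smul_eq_mul]
  have h1 := h0.1
  have h2 := h0.2
  field_simp
  linear_combination this

/-! ### Transfer functions -/

section Transfer

variable {n : ℕ} {A : Matrix (Fin n) (Fin n) ℂ}

theorem matOp_pow (A : Matrix (Fin n) (Fin n) ℂ) (j : ℕ) : matOp (A ^ j) = matOp A ^ j := by
  induction j with
  | zero => exact matOp_one n
  | succ j ih => rw [pow_succ, pow_succ, matOp_mul, ih]; rfl

theorem IsStable.summable_norm_matOp_pow (hA : IsStable A) :
    Summable fun j : ℕ => ‖matOp (A ^ j)‖ := by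
  obtain ⟨r, hr0, hr1, hr⟩ := hA.exists_bound
  refine Summable.of_norm_bounded_eventually_nat (summable_geometric_of_lt_one hr0 hr1) ?_
  filter_upwards [hr] with j hj
  rw [norm_norm]
  exact hj

/-- The powers of `A` are norm-summable, so the Neumann series of `z A` converges on the whole
closed disc, boundary included. -/
theorem IsStable.neumann (hA : IsStable A) {z : ℂ} (hz : ‖z‖ ≤ 1) :
    IsUnit (1 - z • A) ∧ HasSum (fun j : ℕ => z ^ j • matOp (A ^ j)) (matOp (1 - z • A)⁻¹) := by
  set x : Vec n →L[ℂ] Vec n := matOp (z • A) with hx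
  have hxp : ∀ j, x ^ j = z ^ j • matOp (A ^ j) := fun j => by
    rw [hx, matOp_smul, smul_pow, matOp_pow]
  have hs : Summable (x ^ ·) := by
    refine Summable.of_norm_bounded hA.summable_norm_matOp_pow fun j => ?_
    simp only [hxp]
    rw [norm_smul, norm_pow]
    exact mul_le_of_le_one_left (norm_nonneg _) (pow_le_one₀ (norm_nonneg _) hz)
  obtain ⟨S, hS⟩ := matOp_surjective (∑' j, x ^ j)
  have h1 : S * (1 - z • A) = 1 := by
    apply matOp_injective
    rw [matOp_mul, matOp_sub, matOp_one, hS]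
    exact hs.tsum_pow_mul_one_sub
  refine ⟨IsUnit.of_mul_eq_one_right S h1, ?_⟩
  rw [Matrix.inv_eq_left_inv h1, hS]
  simpa only [hxp] using hs.hasSum

variable {k l : ℕ} (D : Matrix (Fin k) (Fin l) ℂ) (C : Matrix (Fin k) (Fin n) ℂ)
  (Γ : Matrix (Fin n) (Fin l) ℂ)

/-- Cramer's rule: the common denominator is `det (I - z A)`, which stability keeps nonzero on the
closed disc. -/
theorem IsStable.isStableRational_transfer (hA : IsStable A) :
    IsStableRational fun z => D + z • (C * (1 - z • A)⁻¹ * Γ) := by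
  let N : Matrix (Fin n) (Fin n) (Polynomial ℂ) := 1 - (Polynomial.X : Polynomial ℂ) • A.map Polynomial.C
  have hN : ∀ z : ℂ, N.map (Polynomial.eval z) = 1 - z • A := fun z => by
    ext i j
    simp [N, Matrix.one_apply]
    split_ifs <;> simp [mul_comm]
  have hdet : ∀ z : ℂ, N.det.eval z = (1 - z • A).det := fun z => by
    rw [← hN, ← Polynomial.coe_evalRingHom, RingHom.map_det]
    rfl
  have hadj : ∀ z : ℂ, N.adjugate.map (Polynomial.eval z) = (1 - z • A).adjugate := fun z => by
    rw [← hN]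
    exact RingHom.map_adjugate (Polynomial.evalRingHom z) N
  refine ⟨N.det • D.map Polynomial.C + (Polynomial.X : Polynomial ℂ) •
    (C.map Polynomial.C * N.adjugate * Γ.map Polynomial.C), N.det, fun z hz => ?_, fun z hz => ?_⟩
  · rw [hdet]
    exact ((Matrix.isUnit_iff_isUnit_det _).mp (hA.neumann hz).1).ne_zero
  · have e : (N.det • D.map Polynomial.C + (Polynomial.X : Polynomial ℂ) •
        (C.map Polynomial.C * N.adjugate * Γ.map Polynomial.C)).map (Polynomial.eval z)
        = N.det.eval z • D + z • (C * (1 - z • A).adjugate * Γ) := by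
      rw [← hadj]
      ext i j
      simp [Matrix.mul_apply, Polynomial.eval_finsetSum]
    change D + z • (C * (1 - z • A)⁻¹ * Γ) = _
    rw [e, smul_add, smul_smul, inv_mul_cancel₀ hz, one_smul, Matrix.inv_def,
      Ring.inverse_eq_inv', ← hdet, Matrix.mul_smul, Matrix.smul_mul, smul_comm]

/-- The power series coefficients of `D + z C (I - z A)⁻¹ Γ`. -/
def transferCoeff (D : Matrix (Fin k) (Fin l) ℂ) (C : Matrix (Fin k) (Fin n) ℂ)
    (A : Matrix (Fin n) (Fin n) ℂ) (Γ : Matrix (Fin n) (Fin l) ℂ) : ℕ → Matrix (Fin k) (Fin l) ℂ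
  | 0 => D
  | j + 1 => C * A ^ j * Γ

theorem IsStable.hasAnalyticSeries_transfer (hA : IsStable A) :
    HasAnalyticSeries (fun z => D + z • (C * (1 - z • A)⁻¹ * Γ))
      (fun j => matOp (transferCoeff D C A Γ j)) where
  continuousOn := (hA.isStableRational_transfer D C Γ).continuousOn_sphere
  summable := by
    rw [← summable_nat_add_iff 1]
    refine Summable.of_nonneg_of_le (fun _ => norm_nonneg _) (fun j => ?_)
      ((hA.summable_norm_matOp_pow.mul_left ‖matOp C‖).mul_right ‖matOp Γ‖)
    rw [transferCoeff, matOp_mul, matOp_mul]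
    exact (ContinuousLinearMap.opNorm_comp_le _ _).trans
      (mul_le_mul_of_nonneg_right (ContinuousLinearMap.opNorm_comp_le _ _) (norm_nonneg _))
  hasSum z hz := by
    have h1 := (((hA.neumann hz).2.mapL
      (ContinuousLinearMap.compL ℂ (Vec l) (Vec n) (Vec k) (matOp C) ∘L
        (ContinuousLinearMap.compL ℂ (Vec l) (Vec n) (Vec n)).flip (matOp Γ))).const_smul z)
    rw [matOp_add, matOp_smul, matOp_mul, matOp_mul, add_comm]
    have e0 : matOp D = ∑ i ∈ Finset.range 1, z ^ i • matOp (transferCoeff D C A Γ i) := by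
      simp [transferCoeff]
    rw [e0, ← hasSum_nat_add_iff (f := fun j => z ^ j • matOp (transferCoeff D C A Γ j))]
    have e1 : (fun j => z ^ (j + 1) • matOp (transferCoeff D C A Γ (j + 1))) = fun j => z •
        (ContinuousLinearMap.compL ℂ (Vec l) (Vec n) (Vec k) (matOp C) ∘L
          (ContinuousLinearMap.compL ℂ (Vec l) (Vec n) (Vec n)).flip (matOp Γ))
          (z ^ j • matOp (A ^ j)) := by
      funext j
      change z ^ (j + 1) • matOp (C * A ^ j * Γ) = _
      rw [matOp_mul, matOp_mul, pow_succ', mul_smul, map_smul]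
      rfl
    rw [e1]
    exact h1

end Transfer

/-! ### Observability operators -/

section Observability

variable {k n : ℕ} {A : Matrix (Fin n) (Fin n) ℂ}

theorem obsOp_apply (C : Matrix (Fin k) (Fin n) ℂ) (hA : IsStable A) (x : Vec n) (i : ℕ) :
    obsOp C hA x i = matOp (C * A ^ i) x := rfl

theorem adjoint_firstEmb_comp_obsOp (C : Matrix (Fin k) (Fin n) ℂ) (hA : IsStable A) :
    (firstEmb k).adjoint ∘L obsOp C hA = matOp C := by
  ext1 x
  rw [ContinuousLinearMap.comp_apply, adjoint_firstEmb_apply, obsOp_apply, pow_zero,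
    Matrix.mul_one]

theorem backShift_comp_obsOp (C : Matrix (Fin k) (Fin n) ℂ) (hA : IsStable A) :
    backShift k ∘L obsOp C hA = obsOp C hA ∘L matOp A := by
  ext1 x
  apply lp.ext
  funext i
  rw [ContinuousLinearMap.comp_apply, ContinuousLinearMap.comp_apply, backShift_apply,
    obsOp_apply, obsOp_apply, pow_succ, ← Matrix.mul_assoc, matOp_mul]
  rfl

/-- An operator that intertwines `A` with the backward shift is an observability operator. -/
theorem eq_obsOp {C : Matrix (Fin k) (Fin n) ℂ} (hA : IsStable A) {X : Vec n →L[ℂ] SeqSpace k}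
    (hC : (firstEmb k).adjoint ∘L X = matOp C) (hX : backShift k ∘L X = X ∘L matOp A) :
    X = obsOp C hA := by
  have key : ∀ (i : ℕ) (x : Vec n), X x i = obsOp C hA x i := by
    intro i
    induction i with
    | zero =>
      intro x
      rw [← adjoint_firstEmb_apply, ← adjoint_firstEmb_apply, ← ContinuousLinearMap.comp_apply, hC,
        ← ContinuousLinearMap.comp_apply, adjoint_firstEmb_comp_obsOp]
    | succ i ih =>
      intro x
      rw [← backShift_apply, ← backShift_apply, ← ContinuousLinearMap.comp_apply, hX,
        ← ContinuousLinearMap.comp_apply, backShift_comp_obsOp]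
      exact ih _
  ext1 x
  exact lp.ext (funext fun i => key i x)

theorem matOp_obsGramian (C : Matrix (Fin k) (Fin n) ℂ) (hA : IsStable A) :
    matOp (obsGramian C A) = (obsOp C hA).adjoint ∘L obsOp C hA := by
  ext1 y
  refine ext_inner_left ℂ fun x => ?_
  rw [ContinuousLinearMap.comp_apply, ContinuousLinearMap.adjoint_inner_right]
  have h1 : HasSum (fun ν : ℕ => matOp ((A ^ ν)ᴴ * Cᴴ * C * A ^ ν)) (matOp (obsGramian C A)) :=
    (summable_obsGramian C hA).hasSum.map (matOpEquiv n n) continuous_matOp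
  have h2 := (h1.mapL (ContinuousLinearMap.apply ℂ (Vec n) y)).mapL (innerSL ℂ x)
  refine h2.unique ?_
  convert lp.hasSum_inner (𝕜 := ℂ) (obsOp C hA x) (obsOp C hA y) using 2 with ν
  have e : (A ^ ν)ᴴ * Cᴴ * C * A ^ ν = (C * A ^ ν)ᴴ * (C * A ^ ν) := by
    rw [Matrix.conjTranspose_mul, Matrix.mul_assoc]
  change inner ℂ x (matOp ((A ^ ν)ᴴ * Cᴴ * C * A ^ ν) y) = _
  rw [e, matOp_mul, matOp_conjTranspose, ContinuousLinearMap.comp_apply,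
    ContinuousLinearMap.adjoint_inner_right]
  rfl

end Observability

/-! ### The first column of `T_R` -/

section FirstColumn

variable {m n : ℕ} {A : Matrix (Fin n) (Fin n) ℂ}

/-- For `|z| = 1` one has `z I - A* = z (I - z A)*`, so the last term of `R` is the adjoint of the
first. The summand `0` puts that term in transfer function form with vanishing constant coefficient.
-/
theorem realizedR_eq_add_paraConj (hA : IsStable A) (C : Matrix (Fin m) (Fin n) ℂ)
    (Γ : Matrix (Fin n) (Fin m) ℂ) (R₀ : Matrix (Fin m) (Fin m) ℂ) (t : UnitAddCircle) :
    realizedR A C Γ R₀ (AddCircle.toCircle t) =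
      (R₀ + (AddCircle.toCircle t : ℂ) • (C * (1 - (AddCircle.toCircle t : ℂ) • A)⁻¹ * Γ)) +
      paraConj (fun z => 0 + z • (C * (1 - z • A)⁻¹ * Γ)) (AddCircle.toCircle t) := by
  rw [paraConj_toCircle]
  set z : ℂ := (AddCircle.toCircle t : ℂ) with hz
  have hz1 : ‖z‖ = 1 := norm_toCircle t
  have hz0 : z ≠ 0 := by rintro h; simp [h] at hz1
  have hu := (hA.neumann hz1.le).1
  have e : z • (1 : Matrix (Fin n) (Fin n) ℂ) - Aᴴ = z • (1 - z • A)ᴴ := by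
    rw [Matrix.conjTranspose_sub, Matrix.conjTranspose_one, Matrix.conjTranspose_smul, smul_sub,
      smul_smul]
    have : z * star z = 1 := by
      rw [Complex.star_def, Complex.mul_conj, Complex.normSq_eq_norm_sq, hz1]; simp
    rw [this, one_smul]
  have hd : IsUnit ((1 - z • A)ᴴ).det := by
    rw [← Matrix.isUnit_iff_isUnit_det]
    exact hu.star
  have e2 : (z • (1 - z • A)ᴴ)⁻¹ = z⁻¹ • ((1 - z • A)ᴴ)⁻¹ := by
    apply Matrix.inv_eq_left_inv
    rw [smul_mul_smul_comm, inv_mul_cancel₀ hz0, Matrix.nonsing_inv_mul _ hd, one_smul]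
  rw [realizedR, e, e2, zero_add, Matrix.conjTranspose_smul,
    Matrix.conjTranspose_mul, Matrix.conjTranspose_mul, Matrix.conjTranspose_nonsing_inv,
    Complex.inv_eq_conj hz1, Matrix.mul_smul, Matrix.smul_mul, Matrix.mul_assoc Γᴴ]
  rw [add_comm (z • _) R₀]
  rfl

/-- The coanalytic part of `R` has no constant term, so it contributes nothing to the first column.
-/
theorem toeplitz_realizedR_comp_firstEmb (hA : IsStable A) (C : Matrix (Fin m) (Fin n) ℂ)
    (Γ : Matrix (Fin n) (Fin m) ℂ) (R₀ : Matrix (Fin m) (Fin m) ℂ) :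
    toeplitz (realizedR A C Γ R₀) ∘L firstEmb m =
      toeplitz (fun z => R₀ + z • (C * (1 - z • A)⁻¹ * Γ)) ∘L firstEmb m := by
  have hF := hA.hasAnalyticSeries_transfer R₀ C Γ
  have hG := hA.hasAnalyticSeries_transfer 0 C Γ
  have hG' := continuousOn_paraConj hG.continuousOn
  rw [toeplitz_congr (continuousOn_realizedR hA C Γ R₀) (hF.continuousOn.add hG')
    (Eventually.of_forall fun t => congrArg matOp (realizedR_eq_add_paraConj hA C Γ R₀ t))]
  refine (congrArg (· ∘L firstEmb m) (toeplitz_add hF.continuousOn hG')).trans ?_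
  have h0 : (toeplitz fun z => 0 + z • (C * (1 - z • A)⁻¹ * Γ)).adjoint ∘L firstEmb m = 0 := by
    have h1 := congrArg ContinuousLinearMap.adjoint hG.adjoint_firstEmb_comp_toeplitz
    rw [ContinuousLinearMap.adjoint_comp, ContinuousLinearMap.adjoint_adjoint] at h1
    rw [h1, show matOp (transferCoeff 0 C A Γ 0) = 0 from map_zero (matOpEquiv m m),
      ContinuousLinearMap.zero_comp, map_zero]
  rw [toeplitz_paraConj hG.continuousOn, ContinuousLinearMap.add_comp, h0, add_zero]

theorem adjoint_firstEmb_toeplitz_realizedR (hA : IsStable A) (C : Matrix (Fin m) (Fin n) ℂ)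
    (Γ : Matrix (Fin n) (Fin m) ℂ) (R₀ : Matrix (Fin m) (Fin m) ℂ) :
    (firstEmb m).adjoint ∘L toeplitz (realizedR A C Γ R₀) ∘L firstEmb m = matOp R₀ := by
  rw [toeplitz_realizedR_comp_firstEmb hA]
  ext1 u
  exact (adjoint_firstEmb_apply _).trans
    ((hA.hasAnalyticSeries_transfer R₀ C Γ).toeplitz_single_zero_apply u 0)

theorem backShift_toeplitz_realizedR (hA : IsStable A) (C : Matrix (Fin m) (Fin n) ℂ)
    (Γ : Matrix (Fin n) (Fin m) ℂ) (R₀ : Matrix (Fin m) (Fin m) ℂ) :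
    backShift m ∘L toeplitz (realizedR A C Γ R₀) ∘L firstEmb m = obsOp C hA ∘L matOp Γ := by
  rw [toeplitz_realizedR_comp_firstEmb hA]
  ext1 u
  apply lp.ext
  funext i
  refine ((hA.hasAnalyticSeries_transfer R₀ C Γ).toeplitz_single_zero_apply u (i + 1)).trans ?_
  rw [ContinuousLinearMap.comp_apply, obsOp_apply]
  exact DFunLike.congr_fun (matOp_mul (C * A ^ i) Γ) u

end FirstColumn

/-! ### Invertibility -/

theorem _root_.ContinuousLinearMap.IsInvertible.adjoint_comp_adjoint_inverse {E F : Type*}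
    [NormedAddCommGroup E] [InnerProductSpace ℂ E] [CompleteSpace E]
    [NormedAddCommGroup F] [InnerProductSpace ℂ F] [CompleteSpace F]
    {T : E →L[ℂ] F} (hT : T.IsInvertible) :
    T.adjoint ∘L T.inverse.adjoint = .id ℂ _ := by
  rw [← ContinuousLinearMap.adjoint_comp, hT.inverse_comp_self]
  exact ContinuousLinearMap.adjoint_id

theorem _root_.ContinuousLinearMap.IsInvertible.adjoint_inverse_comp_adjoint {E F : Type*}
    [NormedAddCommGroup E] [InnerProductSpace ℂ E] [CompleteSpace E]
    [NormedAddCommGroup F] [InnerProductSpace ℂ F] [CompleteSpace F]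
    {T : E →L[ℂ] F} (hT : T.IsInvertible) :
    T.inverse.adjoint ∘L T.adjoint = .id ℂ _ := by
  rw [← ContinuousLinearMap.adjoint_comp, hT.self_comp_inverse]
  exact ContinuousLinearMap.adjoint_id

theorem _root_.ContinuousLinearMap.IsInvertible.adjoint {E F : Type*}
    [NormedAddCommGroup E] [InnerProductSpace ℂ E] [CompleteSpace E]
    [NormedAddCommGroup F] [InnerProductSpace ℂ F] [CompleteSpace F]
    {T : E →L[ℂ] F} (hT : T.IsInvertible) : T.adjoint.IsInvertible :=
  .of_inverse hT.adjoint_comp_adjoint_inverse hT.adjoint_inverse_comp_adjoint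

theorem _root_.ContinuousLinearMap.IsInvertible.inverse_adjoint {E F : Type*}
    [NormedAddCommGroup E] [InnerProductSpace ℂ E] [CompleteSpace E]
    [NormedAddCommGroup F] [InnerProductSpace ℂ F] [CompleteSpace F]
    {T : E →L[ℂ] F} (hT : T.IsInvertible) : T.adjoint.inverse = T.inverse.adjoint := by
  ext1 x
  rw [hT.adjoint.inverse_apply_eq, ← ContinuousLinearMap.comp_apply,
    hT.adjoint_comp_adjoint_inverse]
  rfl

/-- The left inverse `L` and the isometric Hardy embeddings bound `toeplitz Ω` below, hence its
range is closed; being dense, it is everything. -/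
theorem HasAnalyticSeries.isInvertible_toeplitz {k l : ℕ} {Ω : ℂ → Matrix (Fin k) (Fin l) ℂ}
    {φ : ℕ → Vec l →L[ℂ] Vec k} (h : HasAnalyticSeries Ω φ) {L : ℂ → Matrix (Fin l) (Fin k) ℂ}
    (hL : mulOp L ∘L mulOp Ω = .id ℂ _) (hd : DenseRange (toeplitz Ω)) :
    (toeplitz Ω).IsInvertible := by
  have hb : AntilipschitzWith ‖mulOp L‖₊ (toeplitz Ω) := by
    refine ContinuousLinearMap.antilipschitz_of_bound _ fun f => ?_
    have h1 : mulOp L (hardyEmb k (toeplitz Ω f)) = hardyEmb l f := by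
      have h2 := DFunLike.congr_fun h.hardyEmb_comp_toeplitz f
      have h3 := DFunLike.congr_fun hL (hardyEmb l f)
      exact (congrArg (mulOp L) h2).trans h3
    rw [← (hardyEmb l).norm_map f, ← (hardyEmb k).norm_map (toeplitz Ω f), ← h1]
    exact (mulOp L).le_opNorm _
  have hc := hb.isClosed_range (toeplitz Ω).uniformContinuous
  have hs : Function.Surjective (toeplitz Ω) := by
    rw [← Set.range_eq_univ, ← hc.closure_eq]
    exact hd.closure_range
  exact ⟨ContinuousLinearEquiv.ofBijective (toeplitz Ω)
    (LinearMap.ker_eq_bot.mpr hb.injective) (LinearMap.range_eq_top.mpr hs), rfl⟩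

/-- If `T_Ω` is invertible, then so is `Ω(0)`. -/
theorem HasAnalyticSeries.bijective_adjoint_coeff_zero {k l : ℕ}
    {Ω : ℂ → Matrix (Fin k) (Fin l) ℂ} {φ : ℕ → Vec l →L[ℂ] Vec k} (h : HasAnalyticSeries Ω φ)
    (hT : (toeplitz Ω).IsInvertible) : Function.Bijective (φ 0).adjoint := by
  have hE : ∀ p, Function.Injective (firstEmb p) := fun p u v huv => by
    have := congrArg (fun f : SeqSpace p => f 0) huv
    simpa only [firstEmb_apply, lp.single_apply_self] using this
  have h1 : (toeplitz Ω).adjoint ∘L firstEmb k = firstEmb l ∘L (φ 0).adjoint := by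
    have := congrArg ContinuousLinearMap.adjoint h.adjoint_firstEmb_comp_toeplitz
    rwa [ContinuousLinearMap.adjoint_comp, ContinuousLinearMap.adjoint_adjoint,
      ContinuousLinearMap.adjoint_comp, ContinuousLinearMap.adjoint_adjoint] at this
  have hinj := hT.adjoint.injective
  constructor
  · refine Function.Injective.of_comp (f := firstEmb l) ?_
    have : firstEmb l ∘ (φ 0).adjoint = (toeplitz Ω).adjoint ∘ firstEmb k :=
      congrArg DFunLike.coe h1.symm
    rw [this]
    exact hinj.comp (hE k)
  · intro v
    obtain ⟨f, hf⟩ := hT.adjoint.surjective (firstEmb l v)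
    -- The preimage `f` of `E v` is constant: `T* B f = B E v = 0` and `T*` is injective. So its
    -- first entry is the required preimage of `v`.
    have hBf : backShift k f = 0 := by
      apply hinj
      have := DFunLike.congr_fun h.backShift_comp_adjoint_toeplitz f
      rw [ContinuousLinearMap.comp_apply, ContinuousLinearMap.comp_apply, hf] at this
      rw [map_zero, ← this]
      apply lp.ext
      funext i
      exact lp.single_apply_ne (E := fun _ : ℕ => Vec l) 2 0 v (Nat.succ_ne_zero i)
    have hfE : firstEmb k ((firstEmb k).adjoint f) = f := by
      have := DFunLike.congr_fun (firstEmb_backShift_decomp k) f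
      rw [add_apply, ContinuousLinearMap.comp_apply, ContinuousLinearMap.comp_apply, hBf,
        map_zero, add_zero] at this
      exact this
    refine ⟨(firstEmb k).adjoint f, hE l ?_⟩
    have := DFunLike.congr_fun h1 ((firstEmb k).adjoint f)
    rw [ContinuousLinearMap.comp_apply, hfE, hf] at this
    exact this.symm

theorem continuousOn_matrix_inv {m : ℕ} {F : ℂ → Matrix (Fin m) (Fin m) ℂ} {s : Set ℂ}
    (hF : ContinuousOn F s) (hu : ∀ z ∈ s, IsUnit (F z)) : ContinuousOn (fun z => (F z)⁻¹) s := by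
  have h1 : ContinuousOn (fun z => (F z).det) s := by
    rw [continuousOn_iff_continuous_domRestrict] at hF ⊢
    exact hF.matrix_det
  have h2 : ContinuousOn (fun z => (F z).adjugate) s := by
    rw [continuousOn_iff_continuous_domRestrict] at hF ⊢
    exact hF.matrix_adjugate
  simp only [Matrix.inv_def, Ring.inverse_eq_inv']
  exact (h1.inv₀ fun z hz => ((Matrix.isUnit_iff_isUnit_det _).mp (hu z hz)).ne_zero).smul h2

/-! ### Outer spectral factors -/

section SpectralFactor

variable {r m n : ℕ} {A : Matrix (Fin n) (Fin n) ℂ} {C : Matrix (Fin m) (Fin n) ℂ}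
  {Γ : Matrix (Fin n) (Fin m) ℂ} {R₀ : Matrix (Fin m) (Fin m) ℂ}
  {Φ : ℂ → Matrix (Fin r) (Fin m) ℂ}

theorem IsOuterSpectralFactor.toeplitz_eq (hA : IsStable A)
    (hΦ : IsOuterSpectralFactor (realizedR A C Γ R₀) Φ) :
    toeplitz (realizedR A C Γ R₀) = (toeplitz Φ).adjoint ∘L toeplitz Φ := by
  obtain ⟨φ, hφ⟩ := hΦ.stableRational.exists_hasAnalyticSeries
  have hc := continuousOn_paraConj hφ.continuousOn
  rw [toeplitz_congr (continuousOn_realizedR hA C Γ R₀) (continuousOn_matrix_mul hc hφ.continuousOn)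
    hΦ.factorization.boundary_ae_eq, hφ.toeplitz_mul hc, toeplitz_paraConj hφ.continuousOn]

theorem IsOuterSpectralFactor.isInvertible_toeplitz (hA : IsStable A)
    (hR : ∀ ζ : ℂ, ‖ζ‖ = 1 → (realizedR A C Γ R₀ ζ).PosDef)
    (hΦ : IsOuterSpectralFactor (realizedR A C Γ R₀) Φ) : (toeplitz Φ).IsInvertible := by
  obtain ⟨φ, hφ⟩ := hΦ.stableRational.exists_hasAnalyticSeries
  have hc := continuousOn_paraConj hφ.continuousOn
  have hRc := continuousOn_realizedR hA C Γ R₀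
  have hRu : ∀ z ∈ Metric.sphere (0 : ℂ) 1, IsUnit (realizedR A C Γ R₀ z) := fun z hz =>
    (hR z (mem_sphere_zero_iff_norm.mp hz)).isUnit
  have hRi := continuousOn_matrix_inv hRc hRu
  have hΦΦ := continuousOn_matrix_mul hc hφ.continuousOn
  -- On the circle `Φ* Φ = R` is invertible, so `R⁻¹ Φ*` is a left inverse of `Φ`.
  refine hφ.isInvertible_toeplitz (L := fun z => (realizedR A C Γ R₀ z)⁻¹ * paraConj Φ z) ?_
    hΦ.outer
  rw [mulOp_mul hRi hc, ContinuousLinearMap.comp_assoc, ← mulOp_mul hc hφ.continuousOn,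
    ← mulOp_congr hRc hΦΦ hΦ.factorization.boundary_ae_eq, ← mulOp_mul hRi hRc, ← mulOp_one]
  refine mulOp_congr (continuousOn_matrix_mul hRi hRc) continuousOn_const
    (Eventually.of_forall fun t => congrArg matOp ?_)
  exact Matrix.nonsing_inv_mul _
    ((Matrix.isUnit_iff_isUnit_det _).mp (hRu _ (toCircle_mem_sphere t)))

theorem HasAnalyticSeries.size_eq {φ : ℕ → Vec m →L[ℂ] Vec r} (h : HasAnalyticSeries Φ φ)
    (hT : (toeplitz Φ).IsInvertible) : r = m := by
  have := (LinearEquiv.ofBijective (φ 0).adjoint.toLinearMap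
    (h.bijective_adjoint_coeff_zero hT)).finrank_eq
  simpa using this

theorem stateSpace_eq_top (hA : IsStable A) (hT : (toeplitz Φ).IsInvertible) :
    stateSpace Φ C hA = ⊤ := by
  rw [stateSpace, LinearMap.range_eq_top.mpr hT.adjoint.surjective, Submodule.comap_top]

/-- `T_Φ^{-*} W_obs` intertwines `A` with the backward shift. -/
theorem HasAnalyticSeries.backShift_comp_inverse_adjoint_comp_obsOp
    {φ : ℕ → Vec m →L[ℂ] Vec r} (h : HasAnalyticSeries Φ φ) (hA : IsStable A)
    (hT : (toeplitz Φ).IsInvertible) :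
    backShift r ∘L (toeplitz Φ).inverse.adjoint ∘L obsOp C hA =
      ((toeplitz Φ).inverse.adjoint ∘L obsOp C hA) ∘L matOp A := by
  ext1 x
  apply hT.adjoint.injective
  have h1 := DFunLike.congr_fun h.backShift_comp_adjoint_toeplitz
    ((toeplitz Φ).inverse.adjoint (obsOp C hA x))
  have h2 := fun f => DFunLike.congr_fun hT.adjoint_comp_adjoint_inverse f
  have h3 := DFunLike.congr_fun (backShift_comp_obsOp C hA) x
  simp only [ContinuousLinearMap.comp_apply, ContinuousLinearMap.id_apply] at h1 h2 h3 ⊢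
  rw [← h1, h2, h2, h3]

theorem obsOp_eq_of_matOp_eq {φ : ℕ → Vec m →L[ℂ] Vec r} (h : HasAnalyticSeries Φ φ)
    (hA : IsStable A) (hT : (toeplitz Φ).IsInvertible) {CΦ : Matrix (Fin r) (Fin n) ℂ}
    (hC : matOp CΦ = (firstEmb r).adjoint ∘L (toeplitz Φ).inverse.adjoint ∘L obsOp C hA) :
    obsOp CΦ hA = (toeplitz Φ).inverse.adjoint ∘L obsOp C hA :=
  (eq_obsOp hA hC.symm (h.backShift_comp_inverse_adjoint_comp_obsOp hA hT)).symm

theorem IsOutputMatrix.obsOp_eq (hA : IsStable A) (hT : (toeplitz Φ).IsInvertible)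
    {CΦ : Matrix (Fin r) (Fin n) ℂ} (hC : IsOutputMatrix Φ C Γ hA CΦ) :
    obsOp CΦ hA = (toeplitz Φ).inverse.adjoint ∘L obsOp C hA := by
  ext1 x
  have h1 := hC.intertwining x (by rw [stateSpace_eq_top hA hT]; trivial)
  rw [ContinuousLinearMap.comp_apply, h1]
  exact (DFunLike.congr_fun hT.adjoint_inverse_comp_adjoint _).symm

theorem IsOutputMatrix.matOp_eq (hA : IsStable A) (hT : (toeplitz Φ).IsInvertible)
    {CΦ : Matrix (Fin r) (Fin n) ℂ} (hC : IsOutputMatrix Φ C Γ hA CΦ) :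
    matOp CΦ = (firstEmb r).adjoint ∘L (toeplitz Φ).inverse.adjoint ∘L obsOp C hA := by
  rw [← hC.obsOp_eq hA hT, adjoint_firstEmb_comp_obsOp]

theorem adjoint_toeplitz_comp_obsOp (hA : IsStable A) (hT : (toeplitz Φ).IsInvertible)
    {CΦ : Matrix (Fin r) (Fin n) ℂ}
    (hX : obsOp CΦ hA = (toeplitz Φ).inverse.adjoint ∘L obsOp C hA) :
    (toeplitz Φ).adjoint ∘L obsOp CΦ hA = obsOp C hA := by
  rw [hX, ← ContinuousLinearMap.comp_assoc, hT.adjoint_comp_adjoint_inverse,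
    ContinuousLinearMap.id_comp]

/-- The first column of `T_Φ`, without its top entry, is `W_{Φ,obs} Γ`. -/
theorem IsOuterSpectralFactor.backShift_toeplitz_firstEmb (hA : IsStable A)
    (hΦ : IsOuterSpectralFactor (realizedR A C Γ R₀) Φ) (hT : (toeplitz Φ).IsInvertible)
    {CΦ : Matrix (Fin r) (Fin n) ℂ}
    (hX : obsOp CΦ hA = (toeplitz Φ).inverse.adjoint ∘L obsOp C hA) :
    backShift r ∘L toeplitz Φ ∘L firstEmb m = obsOp CΦ hA ∘L matOp Γ := by
  obtain ⟨φ, hφ⟩ := hΦ.stableRational.exists_hasAnalyticSeries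
  have h1 := backShift_toeplitz_realizedR hA C Γ R₀
  -- Turns `B T_R E = W_obs Γ` into `T* (B T E) = T* (W_{Φ,obs} Γ)`, from which `T*` cancels.
  rw [hΦ.toeplitz_eq hA, ContinuousLinearMap.comp_assoc, ← ContinuousLinearMap.comp_assoc,
    hφ.backShift_comp_adjoint_toeplitz, ← adjoint_toeplitz_comp_obsOp hA hT hX,
    ContinuousLinearMap.comp_assoc, ContinuousLinearMap.comp_assoc] at h1
  ext1 u
  exact hT.adjoint.injective (DFunLike.congr_fun h1 u)

theorem IsOuterSpectralFactor.isOutputMatrix (hA : IsStable A)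
    (hΦ : IsOuterSpectralFactor (realizedR A C Γ R₀) Φ) (hT : (toeplitz Φ).IsInvertible)
    {CΦ : Matrix (Fin r) (Fin n) ℂ}
    (hX : obsOp CΦ hA = (toeplitz Φ).inverse.adjoint ∘L obsOp C hA) :
    IsOutputMatrix Φ C Γ hA CΦ where
  realization := by
    obtain ⟨φ, hφ⟩ := hΦ.stableRational.exists_hasAnalyticSeries
    -- The Taylor coefficients of `Φ` are the entries of the first column of `T`.
    have hcoeff : φ = fun j => matOp (transferCoeff (Φ 0) CΦ A Γ j) := by
      funext j
      rcases j with _ | j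
      · exact hφ.coeff_zero
      · ext1 u
        have h1 := DFunLike.congr_fun (hΦ.backShift_toeplitz_firstEmb hA hT hX) u
        have h2 := congrArg (fun f : SeqSpace r => f j) h1
        refine (hφ.toeplitz_single_zero_apply u (j + 1)).symm.trans (h2.trans ?_)
        exact (DFunLike.congr_fun (matOp_mul (CΦ * A ^ j) Γ) u).symm
    refine hΦ.stableRational.ratEq (hA.isStableRational_transfer (Φ 0) CΦ Γ) fun z hz => ?_
    have h1 := hφ.hasSum z hz.le
    rw [hcoeff] at h1
    exact matOp_injective
      (h1.unique ((hA.hasAnalyticSeries_transfer (Φ 0) CΦ Γ).hasSum z hz.le))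
  intertwining x _ := (DFunLike.congr_fun (adjoint_toeplitz_comp_obsOp hA hT hX) x).symm

theorem IsOuterSpectralFactor.matOp_obsGramian_eq (hA : IsStable A)
    (hΦ : IsOuterSpectralFactor (realizedR A C Γ R₀) Φ) (hT : (toeplitz Φ).IsInvertible)
    {CΦ : Matrix (Fin r) (Fin n) ℂ}
    (hX : obsOp CΦ hA = (toeplitz Φ).inverse.adjoint ∘L obsOp C hA) :
    matOp (obsGramian CΦ A) =
      (obsOp C hA).adjoint ∘L (toeplitz (realizedR A C Γ R₀)).inverse ∘L obsOp C hA := by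
  rw [matOp_obsGramian CΦ hA, hX, hΦ.toeplitz_eq hA,
    hT.adjoint.inverse_comp_of_left, hT.inverse_adjoint, ContinuousLinearMap.adjoint_comp,
    ContinuousLinearMap.adjoint_adjoint]
  rfl

/-- The product `S^* T` split along the first coordinate space and its complement. -/
theorem adjoint_comp_eq_decomp {k : ℕ} {F G : Type*} [NormedAddCommGroup F]
    [InnerProductSpace ℂ F] [CompleteSpace F] [NormedAddCommGroup G] [InnerProductSpace ℂ G]
    (S : F →L[ℂ] SeqSpace k) (T : G →L[ℂ] SeqSpace k) :
    S.adjoint ∘L T = ((firstEmb k).adjoint ∘L S).adjoint ∘L ((firstEmb k).adjoint ∘L T) +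
      (backShift k ∘L S).adjoint ∘L (backShift k ∘L T) := by
  rw [ContinuousLinearMap.adjoint_comp, ContinuousLinearMap.adjoint_comp,
    ContinuousLinearMap.adjoint_adjoint]
  have h := firstEmb_backShift_decomp k
  ext1 x
  have hx := congrArg S.adjoint (DFunLike.congr_fun h (T x))
  rw [add_apply, map_add] at hx
  exact hx.symm

theorem HasAnalyticSeries.adjoint_firstEmb_toeplitz_firstEmb {φ : ℕ → Vec m →L[ℂ] Vec r}
    (h : HasAnalyticSeries Φ φ) :
    (firstEmb r).adjoint ∘L toeplitz Φ ∘L firstEmb m = matOp (Φ 0) := by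
  ext1 u
  rw [← h.coeff_zero]
  exact (adjoint_firstEmb_apply _).trans (h.toeplitz_single_zero_apply u 0)

/-- The top left entry of `T_R = T* T` is the Gram matrix of the first column of `T`, whose entries
are `Φ(0)` on top and `W_{Φ,obs} Γ` below. -/
theorem IsOuterSpectralFactor.conjTranspose_mul_self_eq (hA : IsStable A)
    (hΦ : IsOuterSpectralFactor (realizedR A C Γ R₀) Φ) (hT : (toeplitz Φ).IsInvertible)
    {CΦ : Matrix (Fin r) (Fin n) ℂ}
    (hX : obsOp CΦ hA = (toeplitz Φ).inverse.adjoint ∘L obsOp C hA) :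
    R₀ - Γᴴ * obsGramian CΦ A * Γ = (Φ 0)ᴴ * Φ 0 := by
  obtain ⟨φ, hφ⟩ := hΦ.stableRational.exists_hasAnalyticSeries
  rw [sub_eq_iff_eq_add]
  apply matOp_injective
  rw [matOp_add, matOp_mul, matOp_mul, matOp_mul, matOp_conjTranspose, matOp_conjTranspose,
    matOp_obsGramian CΦ hA, ← adjoint_firstEmb_toeplitz_realizedR hA C Γ R₀, hΦ.toeplitz_eq hA]
  have h := adjoint_comp_eq_decomp (toeplitz Φ ∘L firstEmb m) (toeplitz Φ ∘L firstEmb m)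
  rw [hφ.adjoint_firstEmb_toeplitz_firstEmb, hΦ.backShift_toeplitz_firstEmb hA hT hX,
    ContinuousLinearMap.adjoint_comp, ContinuousLinearMap.adjoint_comp] at h
  exact h

/-- The first entry of `W_obs = T* W_{Φ,obs}` pairs the first column of `T` with `W_{Φ,obs}`, whose
top is `C_Φ` and whose tail is `W_{Φ,obs} A`. -/
theorem IsOuterSpectralFactor.conjTranspose_mul_output_eq (hA : IsStable A)
    (hΦ : IsOuterSpectralFactor (realizedR A C Γ R₀) Φ) (hT : (toeplitz Φ).IsInvertible)
    {CΦ : Matrix (Fin r) (Fin n) ℂ}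
    (hX : obsOp CΦ hA = (toeplitz Φ).inverse.adjoint ∘L obsOp C hA) :
    C - Γᴴ * obsGramian CΦ A * A = (Φ 0)ᴴ * CΦ := by
  obtain ⟨φ, hφ⟩ := hΦ.stableRational.exists_hasAnalyticSeries
  rw [sub_eq_iff_eq_add]
  apply matOp_injective
  rw [matOp_add, matOp_mul, matOp_mul, matOp_mul, matOp_conjTranspose, matOp_conjTranspose,
    matOp_obsGramian CΦ hA, ← adjoint_firstEmb_comp_obsOp C hA,
    ← adjoint_toeplitz_comp_obsOp hA hT hX]
  have h := adjoint_comp_eq_decomp (toeplitz Φ ∘L firstEmb m) (obsOp CΦ hA)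
  rw [hφ.adjoint_firstEmb_toeplitz_firstEmb, hΦ.backShift_toeplitz_firstEmb hA hT hX,
    adjoint_firstEmb_comp_obsOp, backShift_comp_obsOp,
    ContinuousLinearMap.adjoint_comp, ContinuousLinearMap.adjoint_comp] at h
  exact h

end SpectralFactor

/-! ### Multiplication by a constant unitary matrix -/

section Unitary

variable {m n : ℕ} {A : Matrix (Fin n) (Fin n) ℂ} {C : Matrix (Fin m) (Fin n) ℂ}
  {Γ : Matrix (Fin n) (Fin m) ℂ} {R₀ : Matrix (Fin m) (Fin m) ℂ}
  {Φ : ℂ → Matrix (Fin m) (Fin m) ℂ} {U : Matrix (Fin m) (Fin m) ℂ}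

theorem adjoint_toeplitz_const (M : Matrix (Fin m) (Fin m) ℂ) :
    (toeplitz fun _ => M).adjoint = toeplitz fun _ => Mᴴ :=
  (toeplitz_paraConj (Ω := fun _ => M) continuousOn_const).symm

theorem toeplitz_const_comp (M N : Matrix (Fin m) (Fin m) ℂ) :
    (toeplitz fun _ => M) ∘L (toeplitz fun _ => N) = toeplitz fun _ => M * N := by
  obtain ⟨φ, hφ⟩ := (IsStableRational.const N).exists_hasAnalyticSeries
  exact (hφ.toeplitz_mul (Ψ := fun _ => M) continuousOn_const).symm

theorem obsOp_const_mul (hA : IsStable A) (M : Matrix (Fin m) (Fin m) ℂ)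
    (C : Matrix (Fin m) (Fin n) ℂ) :
    obsOp (M * C) hA = (toeplitz fun _ => M) ∘L obsOp C hA := by
  obtain ⟨φ, hφ⟩ := (IsStableRational.const M).exists_hasAnalyticSeries
  obtain ⟨ψ, hψ⟩ := (IsStableRational.const Mᴴ).exists_hasAnalyticSeries
  refine (eq_obsOp hA ?_ ?_).symm
  · rw [← ContinuousLinearMap.comp_assoc, hφ.adjoint_firstEmb_comp_toeplitz, hφ.coeff_zero,
      ContinuousLinearMap.comp_assoc, adjoint_firstEmb_comp_obsOp, matOp_mul]
  -- A constant symbol is also the adjoint of an analytic one, so its Toeplitz operator commutes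
  -- with the backward shift.
  · have h1 := hψ.backShift_comp_adjoint_toeplitz
    rw [adjoint_toeplitz_const, Matrix.conjTranspose_conjTranspose] at h1
    rw [← ContinuousLinearMap.comp_assoc, h1, ContinuousLinearMap.comp_assoc,
      backShift_comp_obsOp, ContinuousLinearMap.comp_assoc]

theorem obsGramian_const_mul (hU : Uᴴ * U = 1) (C : Matrix (Fin m) (Fin n) ℂ) :
    obsGramian (U * C) A = obsGramian C A := by
  refine tsum_congr fun ν => ?_
  have e : (U * C)ᴴ * (U * C) = Cᴴ * C := by
    rw [Matrix.conjTranspose_mul, Matrix.mul_assoc, ← Matrix.mul_assoc Uᴴ, hU, Matrix.one_mul]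
  rw [Matrix.mul_assoc _ _ (U * C), e, ← Matrix.mul_assoc]

theorem IsOuterSpectralFactor.const_mul {R : ℂ → Matrix (Fin m) (Fin m) ℂ}
    (hΦ : IsOuterSpectralFactor R Φ) (hU : Uᴴ * U = 1) (hU' : U * Uᴴ = 1) :
    IsOuterSpectralFactor R fun z => U * Φ z where
  stableRational := hΦ.stableRational.const_mul U
  factorization := by
    filter_upwards [hΦ.factorization] with z hz
    rw [hz, paraConj, paraConj, Matrix.conjTranspose_mul, Matrix.mul_assoc, ← Matrix.mul_assoc Uᴴ,
      hU, Matrix.one_mul]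
  outer := by
    obtain ⟨φ, hφ⟩ := hΦ.stableRational.exists_hasAnalyticSeries
    rw [hφ.toeplitz_mul (Ψ := fun _ => U) continuousOn_const]
    have hs : Function.Surjective (toeplitz fun _ => U) := fun f => by
      refine ⟨(toeplitz fun _ => Uᴴ) f, ?_⟩
      rw [← ContinuousLinearMap.comp_apply, toeplitz_const_comp, hU', toeplitz_one]
      rfl
    exact hs.denseRange.comp hΦ.outer (toeplitz fun _ => U).continuous

theorem IsOutputMatrix.const_mul {hA : IsStable A} (hΦ : IsStableRational Φ)
    (hT : (toeplitz Φ).IsInvertible) {CΦ : Matrix (Fin m) (Fin n) ℂ}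
    (hC : IsOutputMatrix Φ C Γ hA CΦ) (hU : Uᴴ * U = 1) :
    IsOutputMatrix (fun z => U * Φ z) C Γ hA (U * CΦ) where
  realization := by
    filter_upwards [hC.realization] with z hz
    rw [hz, Matrix.mul_add, Matrix.mul_smul, Matrix.mul_assoc U, Matrix.mul_assoc U]
  intertwining x _ := by
    obtain ⟨φ, hφ⟩ := hΦ.exists_hasAnalyticSeries
    have h1 : (toeplitz fun z => U * Φ z).adjoint ∘L obsOp (U * CΦ) hA = obsOp C hA := by
      rw [hφ.toeplitz_mul (Ψ := fun _ => U) continuousOn_const, ContinuousLinearMap.adjoint_comp,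
        obsOp_const_mul, adjoint_toeplitz_const, ContinuousLinearMap.comp_assoc,
        ← ContinuousLinearMap.comp_assoc (toeplitz fun _ => Uᴴ), toeplitz_const_comp, hU,
        toeplitz_one, ContinuousLinearMap.id_comp,
        adjoint_toeplitz_comp_obsOp hA hT (hC.obsOp_eq hA hT)]
    exact (DFunLike.congr_fun h1 x).symm

open scoped MatrixOrder in
-- Polar decomposition: `U = (M* M)^{1/2} M⁻¹`.
theorem exists_unitary_mul_eq_psdSqrt {M : Matrix (Fin m) (Fin m) ℂ} (hM : IsUnit M) :
    ∃ U : Matrix (Fin m) (Fin m) ℂ, Uᴴ * U = 1 ∧ U * Uᴴ = 1 ∧ U * M = psdSqrt (Mᴴ * M) := by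
  have hd := (Matrix.isUnit_iff_isUnit_det M).mp hM
  have h0 : 0 ≤ Mᴴ * M := (Matrix.posSemidef_conjTranspose_mul_self M).nonneg
  have hS : psdSqrt (Mᴴ * M) * psdSqrt (Mᴴ * M) = Mᴴ * M := CFC.sqrt_mul_sqrt_self _ h0
  have hSH : (psdSqrt (Mᴴ * M))ᴴ = psdSqrt (Mᴴ * M) :=
    (Matrix.nonneg_iff_posSemidef.mp (CFC.sqrt_nonneg (Mᴴ * M))).isHermitian
  have hU : (psdSqrt (Mᴴ * M) * M⁻¹)ᴴ * (psdSqrt (Mᴴ * M) * M⁻¹) = 1 := by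
    rw [Matrix.conjTranspose_mul, hSH, Matrix.mul_assoc, ← Matrix.mul_assoc (psdSqrt (Mᴴ * M)), hS,
      Matrix.mul_assoc, Matrix.mul_nonsing_inv _ hd, Matrix.mul_one, ← Matrix.conjTranspose_mul,
      Matrix.mul_nonsing_inv _ hd, Matrix.conjTranspose_one]
  refine ⟨psdSqrt (Mᴴ * M) * M⁻¹, hU, mul_eq_one_comm.mp hU, ?_⟩
  rw [Matrix.mul_assoc, Matrix.nonsing_inv_mul _ hd, Matrix.mul_one]

end Unitary

/-! ### Invertibility of the value at the origin, and the main theorem -/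

theorem HasAnalyticSeries.isUnit_zero {m : ℕ} {Φ : ℂ → Matrix (Fin m) (Fin m) ℂ}
    {φ : ℕ → Vec m →L[ℂ] Vec m} (h : HasAnalyticSeries Φ φ)
    (hT : (toeplitz Φ).IsInvertible) : IsUnit (Φ 0) := by
  have hb := h.bijective_adjoint_coeff_zero hT
  rw [h.coeff_zero, ← matOp_conjTranspose] at hb
  have hu : IsUnit (Φ 0)ᴴ := by
    rw [← Matrix.mulVec_injective_iff_isUnit]
    intro v w hvw
    have := @hb.1 (WithLp.toLp 2 v) (WithLp.toLp 2 w) (congrArg (WithLp.toLp 2) hvw)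
    exact congrArg WithLp.ofLp this
  have := hu.star
  rwa [Matrix.star_eq_conjTranspose, Matrix.conjTranspose_conjTranspose] at this

end OuterFactor

end

open OuterFactor in
theorem proposition5p1 {m n r : ℕ}
    (A : Matrix (Fin n) (Fin n) ℂ) (hA : IsStable A)
    (C : Matrix (Fin m) (Fin n) ℂ) (Γ : Matrix (Fin n) (Fin m) ℂ)
    (R₀ : Matrix (Fin m) (Fin m) ℂ)
    (hR : ∀ ζ : ℂ, ‖ζ‖ = 1 → (realizedR A C Γ R₀ ζ).PosDef)
    (Φ : ℂ → Matrix (Fin r) (Fin m) ℂ)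
    (hΦ : IsOuterSpectralFactor (realizedR A C Γ R₀) Φ) :
    r = m ∧
    (toeplitz Φ).IsInvertible ∧
    stateSpace Φ C hA = ⊤ ∧
    (toeplitz (realizedR A C Γ R₀)).IsInvertible ∧
    (∃! CΦ : Matrix (Fin r) (Fin n) ℂ, IsOutputMatrix Φ C Γ hA CΦ) ∧
    ∀ CΦ : Matrix (Fin r) (Fin n) ℂ, IsOutputMatrix Φ C Γ hA CΦ →
      matOp CΦ =
        (firstEmb r).adjoint ∘L (toeplitz Φ).inverse.adjoint ∘L obsOp C hA ∧
      obsOp CΦ hA = (toeplitz Φ).inverse.adjoint ∘L obsOp C hA ∧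
      matOp (obsGramian CΦ A) =
        (obsOp C hA).adjoint ∘L (toeplitz (realizedR A C Γ R₀)).inverse ∘L obsOp C hA ∧
      (R₀ - Γᴴ * obsGramian CΦ A * Γ).PosDef ∧
      CΦ = Φ 0 * (R₀ - Γᴴ * obsGramian CΦ A * Γ)⁻¹ * (C - Γᴴ * obsGramian CΦ A * A) ∧
      ∃ U : Matrix (Fin m) (Fin r) ℂ, Uᴴ * U = 1 ∧ U * Uᴴ = 1 ∧
        IsOuterSpectralFactor (realizedR A C Γ R₀) (fun z => U * Φ z) ∧
        IsOutputMatrix (fun z => U * Φ z) C Γ hA (U * CΦ) ∧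
        obsGramian (U * CΦ) A = obsGramian CΦ A ∧
        U * Φ 0 = psdSqrt (R₀ - Γᴴ * obsGramian (U * CΦ) A * Γ) := by
  have hT := hΦ.isInvertible_toeplitz hA hR
  obtain ⟨φ, hφ⟩ := hΦ.stableRational.exists_hasAnalyticSeries
  -- From here on `Φ(0)` is square, so matrix inverses and determinants apply to it.
  obtain rfl := hφ.size_eq hT
  obtain ⟨CΦ, hCΦ⟩ := matOp_surjective
    ((firstEmb r).adjoint ∘L (toeplitz Φ).inverse.adjoint ∘L obsOp C hA)
  have hu := hφ.isUnit_zero hT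
  have hd := (Matrix.isUnit_iff_isUnit_det _).mp hu
  refine ⟨rfl, hT, stateSpace_eq_top hA hT, ?_, ⟨CΦ, ?_, fun CΦ' h' => ?_⟩, fun CΦ h => ?_⟩
  · rw [hΦ.toeplitz_eq hA]
    exact hT.adjoint.comp hT
  · exact hΦ.isOutputMatrix hA hT (obsOp_eq_of_matOp_eq hφ hA hT hCΦ)
  · exact matOp_injective ((h'.matOp_eq hA hT).trans hCΦ.symm)
  · have hX := h.obsOp_eq hA hT
    have hΔ := hΦ.conjTranspose_mul_self_eq hA hT hX
    obtain ⟨U, hU, hU', hUΦ⟩ := exists_unitary_mul_eq_psdSqrt hu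
    refine ⟨h.matOp_eq hA hT, hX, hΦ.matOp_obsGramian_eq hA hT hX, ?_, ?_, U, hU, hU',
      hΦ.const_mul hU hU', h.const_mul hΦ.stableRational hT hU, obsGramian_const_mul hU CΦ, ?_⟩
    · rw [hΔ]
      exact Matrix.PosDef.conjTranspose_mul_self _ (Matrix.mulVec_injective_iff_isUnit.mpr hu)
    · have hd' : IsUnit ((Φ 0)ᴴ).det := (Matrix.isUnit_iff_isUnit_det _).mp hu.star
      -- The right-hand side is `Φ(0) (Φ(0)* Φ(0))⁻¹ Φ(0)* C_Φ`, which collapses to `C_Φ`.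
      rw [hΔ, hΦ.conjTranspose_mul_output_eq hA hT hX, Matrix.mul_inv_rev,
        ← Matrix.mul_assoc (Φ 0) (Φ 0)⁻¹, Matrix.mul_nonsing_inv _ hd, Matrix.one_mul,
        ← Matrix.mul_assoc, Matrix.nonsing_inv_mul _ hd', Matrix.one_mul]
    · rw [obsGramian_const_mul hU CΦ, hΔ, hUΦ]
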